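/- Let $L>0$. For $0<\gamma<2/L$ put $L_\gamma=\frac{2}{\gamma}\big(\sqrt{1+\gamma L/2}-\sqrt{1-\gamma L/2}\big)$ and $$\delta(x)=-\frac{3L_\gamma}{4L}\,\frac{\gamma}{\sqrt{1+\frac{\gamma L}{2}}-\frac{\gamma L_\gamma x}{2L}}\quad(x\in[0,L]),\qquad \Lambda=\begin{pmatrix}1&0\\0&-1\end{pmatrix},\qquad J_0=\begin{pmatrix}1&\frac13\\-\frac13&-1\end{pmatrix}.$$ Let $\langle f,g\rangle=\frac1{2L}\int_0^L(f_1\overline{g_1}+f_2\overline{g_2})\,dx$, and consider in $L^2((0,L);\mathbb C^2)$ the operator $T_\gamma=\Lambda\partial_x+\delta J_0$ and its adjoint $T_\gamma^*=-\Lambda\partial_x+\delta J_0^*$, both with domain $\{w\in H^1((0,L);\mathbb C^2): w_1(0)=-w_2(0),\ w_1(L)=-w_2(L)\}$. For $n\in\mathbb Z$ put $\mu_n^{(0)}=i\pi n/L$ and $\psi_n^{(0)}=\chi_n^{(0)}=(e^{i\pi nx/L},-e^{-i\pi nx/L})$; these are the eigenvalues of $T=\Lambda\partial_x$ (same domain)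 and eigenfunctions of $T$ and, for $\overline{\mu_n^{(0)}}$, of $T^*$. For small $\gamma>0$ let $\mu_n(\gamma)$ be the eigenvalue of $T_\gamma$ that depends continuously on $\gamma$ and tends to $\mu_n^{(0)}$ as $\gamma\to0^+$; let $\psi_n(\gamma)$ be an eigenfunction of $T_\gamma$ for $\mu_n(\gamma)$ and $\chi_n(\gamma)$ an eigenfunction of $T_\gamma^*$ for $\overline{\mu_n(\gamma)}$, normalized by $\langle\psi_n(\gamma),\chi_n^{(0)}\rangle=1$ and $\langle\psi_n^{(0)},\chi_n(\gamma)\rangle=1$. Let $b_n=\langle\chi_n(\gamma),(1,1)\rangle$. **Lemma.** There are $\gamma_0\in(0,2/L)$ and $c,C>0$, depending only on $L$, such that such families $\mu_n,\psi_n,\chi_n$ $(n\in\mathbb Z)$ exist for $\gamma\in(0,\gamma_0)$, and for any such families and every $\gamma\in(0,\gamma_0)$: 1. $(\psi_n(\gamma))_{n\in\mathbb Z}$ is a Riesz basis of $L^2((0,L);\mathbb C^2)$; 2. $|\langle\psi_n(\gamma),\chi_n(\gamma)\rangle|\in(1/2,2)$ for all $n\in\mathbb Z$; 3. $|\mu_n(\gamma)-\mu_n^{(0)}|<\frac1{4L}$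 for all $n\in\mathbb Z$; 4. $b_0=0$ and $\gamma\,\dfrac{c}{|n|}<|b_n|<\dfrac{C}{|n|}$ for all $n\in\mathbb Z\setminus\{0\}$. -/

import Mathlib

open MeasureTheory Set Filter Topology

noncomputable section

namespace WaterTank

/-- The value space `ℂ²` of the state `w = (w₁, w₂)`; the components are `w x 0` and `w x 1`. -/
abbrev C2 : Type := EuclideanSpace ℂ (Fin 2)

/-- The Hilbert space `L²((0, L); ℂ²)`. -/
abbrev L2Space (L : ℝ) : Type := Lp C2 2 (volume.restrict (Ioo (0 : ℝ) L))

/-- `Λ = diag (1, -1)`. -/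
def Lam : Matrix (Fin 2) (Fin 2) ℂ := !![1, 0; 0, -1]

/-- The coupling matrix `J₀`. -/
def J0 : Matrix (Fin 2) (Fin 2) ℂ := !![1, 1 / 3; -(1 / 3), -1]

/-- `L_γ = (2 / γ) (√(1 + γ L / 2) - √(1 - γ L / 2))`. -/
def Lgam (L γ : ℝ) : ℝ :=
  2 / γ * (Real.sqrt (1 + γ * L / 2) - Real.sqrt (1 - γ * L / 2))

/-- The coefficient `δ` of the coupling term. -/
def delta (L γ x : ℝ) : ℝ :=
  -(3 * Lgam L γ / (4 * L)) * (γ / (Real.sqrt (1 + γ * L / 2) - γ * Lgam L γ * x / (2 * L)))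

/-- The expression `Λ ∂ₓ w + δ J₀ w` at the point `x`. -/
def S0 (L γ : ℝ) (w : ℝ → C2) (x : ℝ) : C2 :=
  Matrix.toEuclideanLin Lam (deriv w x) +
    (delta L γ x : ℂ) • Matrix.toEuclideanLin J0 (w x)

/-- The adjoint expression `-Λ ∂ₓ w + δ J₀* w` at the point `x` (`δ` is real). -/
def S0Adj (L γ : ℝ) (w : ℝ → C2) (x : ℝ) : C2 :=
  -Matrix.toEuclideanLin Lam (deriv w x) +
    (delta L γ x : ℂ) • Matrix.toEuclideanLin J0.conjTranspose (w x)

/-- `w` is (the continuous representative of) an element of `H¹((0, L); ℂ²)`: it is absolutely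
continuous on `[0, L]` and its derivative is square integrable. -/
def MemH1 (L : ℝ) (w : ℝ → C2) : Prop :=
  AbsolutelyContinuousOnInterval w 0 L ∧ MemLp (deriv w) 2 (volume.restrict (Ioo (0 : ℝ) L))

/-- The common domain of the operator and of its adjoint: `w ∈ H¹((0, L); ℂ²)` with
`w₁(0) = -w₂(0)` and `w₁(L) = -w₂(L)`. -/
def MemDomain (L : ℝ) (w : ℝ → C2) : Prop :=
  MemH1 L w ∧ w 0 0 = -w 0 1 ∧ w L 0 = -w L 1

/-- `w` is an eigenfunction, for the eigenvalue `z`, of the operator given by the differential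
expression `S` on the above domain. -/
def IsEigenfunction (L : ℝ) (S : (ℝ → C2) → ℝ → C2) (z : ℂ) (w : ℝ → C2) : Prop :=
  MemDomain L w ∧ (∃ x ∈ Icc (0 : ℝ) L, w x ≠ 0) ∧
    ∀ᵐ x ∂(volume.restrict (Ioo (0 : ℝ) L)), S w x = z • w x

/-- The scalar product `⟨f, g⟩ = 1 / (2 L) ∫₀ᴸ (f₁ ḡ₁ + f₂ ḡ₂) dx`. -/
def pairing (L : ℝ) (f g : ℝ → C2) : ℂ :=
  (1 / (2 * L) : ℂ) *
    ∫ x in (0 : ℝ)..L, (f x 0 * (starRingEnd ℂ) (g x 0) + f x 1 * (starRingEnd ℂ) (g x 1))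

/-- The eigenvalue `i π n / L` of `Λ ∂ₓ`. -/
def mu0 (L : ℝ) (n : ℤ) : ℂ := Complex.I * (Real.pi : ℂ) * (n : ℂ) / (L : ℂ)

/-- The function `(e^{i π n x / L}, -e^{-i π n x / L})`: the normalized eigenfunction of `Λ ∂ₓ` for
`i π n / L`, and of its adjoint `-Λ ∂ₓ` for the conjugate eigenvalue `-i π n / L`. -/
def psi0 (L : ℝ) (n : ℤ) (x : ℝ) : C2 :=
  !₂[Complex.exp (Complex.I * (Real.pi : ℂ) * (n : ℂ) * (x : ℂ) / (L : ℂ)),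
    -Complex.exp (-(Complex.I * (Real.pi : ℂ) * (n : ℂ) * (x : ℂ) / (L : ℂ)))]

/-- The constant control profile `(1, 1)`. -/
def controlProfile : ℝ → C2 := fun _ => !₂[1, 1]

/-- The perturbed eigenvalues `μ n γ` and eigenfunctions `ψ n γ`, `χ n γ` for `γ ∈ (0, γ₀)`:
`μ n` is the continuous branch of eigenvalues of `Λ ∂ₓ + δ J₀` that issues from `i π n / L` at
`γ = 0`; `ψ n γ` (resp. `χ n γ`) is an eigenfunction of the operator for `μ n γ` (resp. of the
adjoint for the conjugate of `μ n γ`), normalized against the unperturbed eigenfunction. -/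
structure IsPerturbedEigenfamily (L γ₀ : ℝ) (μ : ℤ → ℝ → ℂ) (ψ χ : ℤ → ℝ → ℝ → C2) : Prop where
  continuousOn : ∀ n, ContinuousOn (μ n) (Ioo 0 γ₀)
  tendsto_zero : ∀ n, Tendsto (μ n) (𝓝[>] 0) (𝓝 (mu0 L n))
  eigen : ∀ n, ∀ γ ∈ Ioo 0 γ₀, IsEigenfunction L (S0 L γ) (μ n γ) (ψ n γ)
  eigen_adj : ∀ n, ∀ γ ∈ Ioo 0 γ₀,
    IsEigenfunction L (S0Adj L γ) ((starRingEnd ℂ) (μ n γ)) (χ n γ)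
  norm_psi : ∀ n, ∀ γ ∈ Ioo 0 γ₀, pairing L (ψ n γ) (psi0 L n) = 1
  norm_chi : ∀ n, ∀ γ ∈ Ioo 0 γ₀, pairing L (psi0 L n) (χ n γ) = 1

/-- A Riesz basis of a Hilbert space: the image of an orthonormal basis under a bounded operator
with bounded inverse. -/
def IsRieszBasis {ι H : Type*} [NormedAddCommGroup H] [InnerProductSpace ℂ H] (v : ι → H) : Prop :=
  ∃ (b : HilbertBasis ι ℂ H) (T : H ≃L[ℂ] H), ∀ i, v i = T (b i)

/-- The functions `v i` lie in `L²((0, L); ℂ²)` and their classes form a Riesz basis of it. (The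
factor `1 / (2 L)` in `pairing` does not affect this property.) -/
def IsRieszBasisL2 {ι : Type*} (L : ℝ) (v : ι → ℝ → C2) : Prop :=
  ∃ h : ∀ i, MemLp (v i) 2 (volume.restrict (Ioo (0 : ℝ) L)),
    IsRieszBasis (fun i => ((h i).toLp (v i) : L2Space L))

/-- The moment `b_n = ⟨χ_n, (1, 1)⟩`. -/
def moment (L : ℝ) (χ : ℤ → ℝ → ℝ → C2) (n : ℤ) (γ : ℝ) : ℂ := pairing L (χ n γ) controlProfile

end WaterTank

end

/-! On `[0, L]` the eigenvalue equations of the operator and of its adjoint are one system `w' =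
systemRhs d σ ζ x w` with `d = δ`, where `σ = -1` for the operator and `σ = 1` for the adjoint. Up
to the weight `exp (σ ∫ d)` the system is skew-adjoint, so `ζ = i s` with `s` real. The Prüfer
substitution `w = α (r e^{iθ}, -r e^{-iθ})` decouples it into `θ' = s - (d / 3) sin 2θ` and `(log
r)' = d (σ + cos (2θ) / 3)`, and the boundary conditions become `sin θ = 0`. Eigenvalues therefore
correspond to `θ 0 = 0`, `θ L = π n`. The angle does not involve `σ`, so `ψ_n` and `χ_n` share it
and differ only in the amplitude.

Shooting gives an `s` for each `n` (`exists_isPruefer_apply_eq`). A comparison argument shows that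
it is unique and Lipschitz in `d` (`IsPruefer.abs_sub_le`), which makes the branches continuous in
`γ`. Conversely, a continuous branch that starts at `i π n / L` keeps its index `n`. For `n = 0` the
angle is zero, whence `b_0 = 0`.

The coefficient has size `γ` and satisfies `d' = -(2/3) d²`. Integration by parts then bounds the
integrals of `d cos 2θ` and `d sin 2θ` by multiples of `γ / |s|`. Hence, for `σ = 0`, the polar
functions are within `O(γ L / |n|)` of the unperturbed eigenfunctions. They are also mutually
orthogonal (`IsPruefer.integral_mul_cos_sub_eq_zero`), and being quadratically close to a Parseval
frame they are complete. Multiplying by bounded scalars and by `exp (-∫ d)` turns them into the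
`ψ_n`, a Riesz basis.

The moments rest on the exact identity `s ∫ r sin θ = 1 - r(L) cos θ(L)` for `σ = 1`, again a
consequence of `d' = -(2/3) d²`. Since `d ≤ -γ / 2`, the amplitude satisfies `r(L) ≤ 1 - γ L / 6`,
so the right-hand side is at least `γ L / 6` whatever the sign of the cosine, while `|s|` is
comparable to `|n| / L`. -/

noncomputable section

namespace WaterTank

open scoped ComplexConjugate ENNReal

/-! ### The Prüfer angle: existence, comparison, shooting -/

/-- `θ` is the Prüfer angle, for the spectral parameter `s`, of the system with coefficient `d`. -/
structure IsPruefer (L : ℝ) (d : ℝ → ℝ) (s : ℝ) (θ : ℝ → ℝ) : Prop where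
  continuous : Continuous θ
  zero : θ 0 = 0
  hasDerivAt : ∀ x ∈ Icc (0 : ℝ) L, HasDerivAt θ (s - d x / 3 * Real.sin (2 * θ x)) x

theorem exists_isPruefer {L k : ℝ} (hL : 0 ≤ L) {d : ℝ → ℝ} (hd : Continuous d)
    (hk : ∀ x, |d x| ≤ k) (s : ℝ) : ∃ θ, IsPruefer L d s θ := by
  have hk0 : 0 ≤ k := (abs_nonneg _).trans (hk 0)
  let f : ℝ → ℝ → ℝ := fun x y => s - d x / 3 * Real.sin (2 * y)
  have hfc : ∀ y : ℝ → ℝ, Continuous y → Continuous fun x => f x (y x) := by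
    intro y hy
    simp only [f]
    fun_prop
  have hsin : LipschitzWith 2 fun y : ℝ => Real.sin (2 * y) := by
    refine LipschitzWith.of_dist_le_mul fun y z => ?_
    have := Real.lipschitzWith_sin.dist_le_mul (2 * y) (2 * z)
    simp only [NNReal.coe_one, one_mul, NNReal.coe_ofNat, Real.dist_eq] at this ⊢
    rwa [← mul_sub, abs_mul, abs_two] at this
  -- The vector field is bounded by `|s| + k`, so a ball of radius `(|s| + k) L` cannot be left
  -- before `L` and one Picard–Lindelöf step covers the whole interval.
  have hpl : IsPicardLindelof f (⟨0, left_mem_Icc.2 hL⟩ : Icc (0 : ℝ) L) 0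
      (Real.toNNReal ((|s| + k) * L)) 0 (Real.toNNReal (|s| + k)) (Real.toNNReal k * 2) := by
    refine ⟨fun t _ => ?_, fun y _ => (hfc (fun _ => y) continuous_const).continuousOn,
      fun t _ y _ => ?_, ?_⟩
    · refine (LipschitzWith.of_dist_le_mul fun y z => ?_).lipschitzOnWith
      have h1 := hsin.dist_le_mul y z
      have h2 : dist (f t y) (f t z) =
          |d t| / 3 * dist (Real.sin (2 * y)) (Real.sin (2 * z)) := by
        simp only [f, Real.dist_eq]
        rw [show s - d t / 3 * Real.sin (2 * y) - (s - d t / 3 * Real.sin (2 * z)) =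
          -(d t / 3) * (Real.sin (2 * y) - Real.sin (2 * z)) by ring, abs_mul, abs_neg, abs_div,
          abs_of_pos (show (0 : ℝ) < 3 by norm_num)]
      rw [h2]
      push_cast
      rw [Real.coe_toNNReal _ hk0, mul_assoc]
      refine mul_le_mul (by linarith [hk t, abs_nonneg (d t)]) h1 dist_nonneg hk0
    · rw [Real.coe_toNNReal _ (by positivity), Real.norm_eq_abs]
      refine (abs_sub _ _).trans ?_
      have h1 : |d t / 3 * Real.sin (2 * y)| ≤ |d t| / 3 * 1 := by
        rw [abs_mul, abs_div, abs_of_pos (show (0 : ℝ) < 3 by norm_num)]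
        gcongr
        exact Real.abs_sin_le_one _
      linarith [hk t, abs_nonneg (d t)]
    · simp [hL, Real.coe_toNNReal _ (show 0 ≤ |s| + k by positivity),
        Real.coe_toNNReal _ (show 0 ≤ (|s| + k) * L by positivity)]
  obtain ⟨α, hα0, hα⟩ := hpl.exists_eq_forall_mem_Icc_hasDerivWithinAt₀
  -- Extending the solution by constants and integrating the resulting continuous right-hand side
  -- gives two-sided derivatives at the end points as well.
  let β : ℝ → ℝ := fun x => α (projIcc 0 L hL x)
  have hβ : Continuous β := by
    have h1 : ContinuousOn α (Icc 0 L) := fun x hx => (hα x hx).continuousWithinAt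
    exact h1.domRestrict.comp continuous_projIcc
  have hg := hfc β hβ
  refine ⟨fun x => ∫ t in (0 : ℝ)..x, f t (β t), ?_, by simp, fun x hx => ?_⟩
  · exact intervalIntegral.continuous_primitive (fun a b => hg.intervalIntegrable a b) 0
  · have h1 : ∀ y ∈ Icc 0 L, ∫ t in (0 : ℝ)..y, f t (β t) = α y := by
      intro y hy
      have h2 : ∫ t in (0 : ℝ)..y, f t (α t) = α y - α 0 := by
        refine intervalIntegral.integral_eq_sub_of_hasDerivAt_of_le hy.1
          (fun x hx => ((hα x ⟨hx.1, hx.2.trans hy.2⟩).continuousWithinAt.mono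
            (Icc_subset_Icc_right hy.2)))
          (fun x hx => (hα x ⟨hx.1.le, hx.2.le.trans hy.2⟩).hasDerivAt
            (Icc_mem_nhds hx.1 (hx.2.trans_le hy.2))) ?_
        refine (hg.intervalIntegrable 0 y).congr fun t ht => ?_
        rw [uIoc_of_le hy.1] at ht
        simp [β, projIcc_of_mem hL (show t ∈ Icc 0 L from ⟨ht.1.le, ht.2.trans hy.2⟩)]
      have h3 : ∫ t in (0 : ℝ)..y, f t (β t) = ∫ t in (0 : ℝ)..y, f t (α t) := by
        refine intervalIntegral.integral_congr fun t ht => ?_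
        rw [uIcc_of_le hy.1] at ht
        simp [β, projIcc_of_mem hL (show t ∈ Icc 0 L from ⟨ht.1, ht.2.trans hy.2⟩)]
      rw [h3, h2]
      rw [show α 0 = 0 from hα0, sub_zero]
    have h4 := intervalIntegral.integral_hasDerivAt_right (hg.intervalIntegrable 0 x)
      (hg.stronglyMeasurableAtFilter _ _) hg.continuousAt
    convert! h4 using 1
    rw [h1 x hx]
    simp [f, β, projIcc_of_mem hL hx]

/-- A positive forcing pushes the solution of a linear equation up. -/
theorem pos_of_hasDerivAt_linear {L : ℝ} (hL : 0 < L) {φ h g : ℝ → ℝ} (hh : Continuous h)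
    (hg : ∀ x ∈ Icc 0 L, 0 < g x) (h0 : φ 0 = 0)
    (hφ : ∀ x ∈ Icc 0 L, HasDerivAt φ (g x - h x * φ x) x) : 0 < φ L := by
  let H : ℝ → ℝ := fun x => ∫ t in (0 : ℝ)..x, h t
  have hH : ∀ x, HasDerivAt H (h x) x := fun x =>
    intervalIntegral.integral_hasDerivAt_right (hh.intervalIntegrable 0 x)
      (hh.stronglyMeasurableAtFilter _ _) hh.continuousAt
  have hD : ∀ x ∈ Icc 0 L, HasDerivAt (fun x => Real.exp (H x) * φ x) (Real.exp (H x) * g x) x := by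
    intro x hx
    convert! (hH x).exp.mul (hφ x hx) using 1
    ring
  have hmono : StrictMonoOn (fun x => Real.exp (H x) * φ x) (Icc 0 L) := by
    refine strictMonoOn_of_deriv_pos (convex_Icc _ _)
      (fun x hx => (hD x hx).continuousAt.continuousWithinAt) fun x hx => ?_
    rw [interior_Icc] at hx
    have hx' := Ioo_subset_Icc_self hx
    rw [(hD x hx').deriv]
    exact mul_pos (Real.exp_pos _) (hg x hx')
  have := hmono (left_mem_Icc.2 hL.le) (right_mem_Icc.2 hL.le) hL
  simp only [h0, mul_zero] at this
  exact pos_of_mul_pos_right this (Real.exp_pos _).le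

/-- With `sinc` the difference quotient stays continuous where the two angles meet, so the
difference of two Prüfer angles solves a linear equation with continuous coefficient. -/
theorem sin_two_mul_sub_sin_two_mul (a b : ℝ) :
    Real.sin (2 * a) - Real.sin (2 * b) = 2 * Real.cos (a + b) * Real.sinc (a - b) * (a - b) := by
  have h : Real.sinc (a - b) * (a - b) = Real.sin (a - b) := by
    by_cases h0 : a - b = 0
    · simp [h0]
    · rw [Real.sinc_of_ne_zero h0, div_mul_cancel₀ _ h0]
  have h1 := Real.sin_add (a + b) (a - b)
  have h2 := Real.sin_sub (a + b) (a - b)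
  rw [show (a + b) + (a - b) = 2 * a by ring] at h1
  rw [show (a + b) - (a - b) = 2 * b by ring] at h2
  rw [mul_assoc, h, h1, h2]
  ring

/-- If `s > s' + η / 3`, then `φ = θ - θ'` solves a linear equation with positive forcing and `φ 0 =
0`. This forces `φ L > 0`, against the equality of the end values. -/
theorem IsPruefer.le_add_of_eq {L η s s' : ℝ} (hL : 0 < L) {d d' θ θ' : ℝ → ℝ}
    (hd' : Continuous d') (h : IsPruefer L d s θ) (h' : IsPruefer L d' s' θ')
    (hη : ∀ x ∈ Icc 0 L, |d x - d' x| ≤ η) (hθ : θ L = θ' L) : s ≤ s' + η / 3 := by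
  by_contra! hlt
  have hc := h.continuous
  have hc' := h'.continuous
  have hs := Real.continuous_sinc
  have := pos_of_hasDerivAt_linear hL (φ := fun x => θ x - θ' x)
    (h := fun x => 2 * d' x / 3 * Real.cos (θ x + θ' x) * Real.sinc (θ x - θ' x))
    (g := fun x => s - s' - (d x - d' x) / 3 * Real.sin (2 * θ x)) (by fun_prop) ?_
    (by simp [h.zero, h'.zero]) ?_
  · simp [hθ] at this
  · intro x hx
    have h1 := hη x hx
    have h2 := Real.abs_sin_le_one (2 * θ x)
    have h3 : |(d x - d' x) / 3 * Real.sin (2 * θ x)| ≤ η / 3 * 1 := by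
      rw [abs_mul, abs_div, abs_of_pos (show (0 : ℝ) < 3 by norm_num)]
      exact mul_le_mul (by linarith) h2 (abs_nonneg _) (by linarith [abs_nonneg (d x - d' x)])
    linarith [le_abs_self ((d x - d' x) / 3 * Real.sin (2 * θ x))]
  · intro x hx
    convert! (h.hasDerivAt x hx).sub (h'.hasDerivAt x hx) using 1
    have := sin_two_mul_sub_sin_two_mul (θ x) (θ' x)
    linear_combination (d' x / 3) * this

/-- Comparison of the spectral parameters of two Prüfer angles with the same end value. -/
theorem IsPruefer.abs_sub_le {L η s s' : ℝ} (hL : 0 < L) {d d' θ θ' : ℝ → ℝ}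
    (hd : Continuous d) (hd' : Continuous d') (h : IsPruefer L d s θ) (h' : IsPruefer L d' s' θ')
    (hη : ∀ x ∈ Icc 0 L, |d x - d' x| ≤ η) (hθ : θ L = θ' L) : |s - s'| ≤ η / 3 := by
  rw [abs_le]
  have h1 := h.le_add_of_eq hL hd' h' hη hθ
  have h2 := h'.le_add_of_eq hL hd h (fun x hx => abs_sub_comm (d x) (d' x) ▸ hη x hx) hθ.symm
  constructor <;> linarith

theorem IsPruefer.abs_sub_mul_le {L k s : ℝ} {d θ : ℝ → ℝ} (h : IsPruefer L d s θ)
    (hk : ∀ x, |d x| ≤ k) {x : ℝ} (hx : x ∈ Icc 0 L) : |θ x - s * x| ≤ k / 3 * x := by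
  have hD : ∀ y ∈ Icc 0 L, HasDerivAt (fun y => θ y - s * y) (- (d y / 3 * Real.sin (2 * θ y))) y := by
    intro y hy
    convert! (h.hasDerivAt y hy).sub ((hasDerivAt_id y).const_mul s) using 1
    ring
  have := (convex_Icc 0 L).norm_image_sub_le_of_norm_hasDerivWithin_le (C := k / 3)
    (fun y hy => (hD y hy).hasDerivWithinAt) (fun y _ => ?_)
    (left_mem_Icc.2 (hx.1.trans hx.2)) hx
  · simpa [h.zero, abs_of_nonneg hx.1] using this
  · rw [norm_neg, Real.norm_eq_abs, abs_mul, abs_div, abs_of_pos (show (0 : ℝ) < 3 by norm_num)]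
    have h1 := hk y
    have h2 := Real.abs_sin_le_one (2 * θ y)
    have h3 := abs_nonneg (d y)
    have h4 := abs_nonneg (Real.sin (2 * θ y))
    nlinarith

/-- Shooting in `s`: by Grönwall the end value is continuous in `s`, and it stays within `k L / 3`
of `s L`, so it takes every real value. -/
theorem exists_isPruefer_apply_eq {L k : ℝ} (hL : 0 < L) {d : ℝ → ℝ} (hd : Continuous d)
    (hk : ∀ x, |d x| ≤ k) (y : ℝ) : ∃ s θ, IsPruefer L d s θ ∧ θ L = y := by
  have hk0 : 0 ≤ k := (abs_nonneg _).trans (hk 0)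
  choose Θ hΘ using exists_isPruefer hL.le hd hk
  -- The Lipschitz constant `2 k / 3` would do; `k + 1` keeps `K` nonzero, as the closed form of the
  -- Grönwall bound requires.
  let K : NNReal := Real.toNNReal (2 * (k + 1) / 3)
  have hK : (K : ℝ) = 2 * (k + 1) / 3 := Real.coe_toNNReal _ (by positivity)
  have hK0 : (K : ℝ) ≠ 0 := by rw [hK]; positivity
  have hlip : ∀ s s', dist (Θ s L) (Θ s' L) ≤ dist s s' / K * (Real.exp (K * L) - 1) := by
    intro s s'
    have h1 := dist_le_of_approx_trajectories_ODE (v := fun t y => s - d t / 3 * Real.sin (2 * y))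
      (K := K) (f := Θ s) (g := Θ s') (f' := fun t => s - d t / 3 * Real.sin (2 * Θ s t))
      (g' := fun t => s' - d t / 3 * Real.sin (2 * Θ s' t)) (a := 0) (b := L) (δ := 0) (εf := 0)
      (εg := dist s s') (fun t => ?_) (hΘ s).continuous.continuousOn
      (fun t ht => ((hΘ s).hasDerivAt t (Ico_subset_Icc_self ht)).hasDerivWithinAt)
      (fun t _ => by simp) (hΘ s').continuous.continuousOn
      (fun t ht => ((hΘ s').hasDerivAt t (Ico_subset_Icc_self ht)).hasDerivWithinAt)
      (fun t _ => by rw [dist_sub_right, dist_comm]) (by simp [(hΘ s).zero, (hΘ s').zero]) L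
      (right_mem_Icc.2 hL.le)
    · simpa [gronwallBound_of_K_ne_0 hK0] using h1
    · refine LipschitzWith.of_dist_le_mul fun y z => ?_
      rw [hK, Real.dist_eq, Real.dist_eq]
      have h2 := sin_two_mul_sub_sin_two_mul y z
      rw [show s - d t / 3 * Real.sin (2 * y) - (s - d t / 3 * Real.sin (2 * z)) =
        -(d t / 3) * (Real.sin (2 * y) - Real.sin (2 * z)) by ring, h2, abs_mul, abs_mul _ (y - z),
        ← mul_assoc]
      refine mul_le_mul_of_nonneg_right ?_ (abs_nonneg _)
      rw [abs_mul, abs_mul, abs_neg, abs_div, abs_two, abs_of_pos (show (0 : ℝ) < 3 by norm_num)]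
      have h3 := hk t
      have h4 : |Real.cos (y + z)| * |Real.sinc (y - z)| ≤ 1 := by
        refine mul_le_one₀ (Real.abs_cos_le_one _) (abs_nonneg _) (Real.abs_sinc_le_one _)
      nlinarith [abs_nonneg (d t)]
  have hcont : Continuous fun s => Θ s L := by
    have : LipschitzWith (Real.toNNReal ((Real.exp (K * L) - 1) / K)) fun s => Θ s L := by
      refine LipschitzWith.of_dist_le_mul fun s s' => (hlip s s').trans (le_of_eq ?_)
      have h1 : 0 ≤ (K : ℝ) * L := mul_nonneg K.coe_nonneg hL.le
      have h2 : 0 ≤ (Real.exp (K * L) - 1) / K :=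
        div_nonneg (by linarith [Real.add_one_le_exp ((K : ℝ) * L)]) K.coe_nonneg
      rw [Real.coe_toNNReal _ h2]
      ring
    exact this.continuous
  have hb : ∀ s, |Θ s L - s * L| ≤ k / 3 * L := fun s =>
    (hΘ s).abs_sub_mul_le hk (right_mem_Icc.2 hL.le)
  have h1 : Θ (y / L - k / 3) L ≤ y := by
    have h := (abs_le.1 (hb (y / L - k / 3))).2
    rw [sub_mul, div_mul_cancel₀ _ hL.ne'] at h
    linarith
  have h2 : y ≤ Θ (y / L + k / 3) L := by
    have h := (abs_le.1 (hb (y / L + k / 3))).1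
    rw [add_mul, div_mul_cancel₀ _ hL.ne'] at h
    linarith
  obtain ⟨s, hs⟩ := mem_range_of_exists_le_of_exists_ge hcont ⟨_, h1⟩ ⟨_, h2⟩
  exact ⟨s, Θ s, hΘ s, hs⟩

/-! ### Oscillatory integrals and estimates of angle and amplitude -/

/-- The properties of the coefficient `δ` (extended from `[0, L]` to a continuous function on the
line) on which the spectral analysis relies. -/
structure IsCoefficient (L γ : ℝ) (d : ℝ → ℝ) : Prop where
  continuous : Continuous d
  ge : ∀ x, -(3 / 2 * γ) ≤ d x
  le : ∀ x, d x ≤ -(γ / 2)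
  hasDerivAt : ∀ x ∈ Ioo 0 L, HasDerivAt d (-(2 / 3) * d x ^ 2) x

/-- The amplitude that belongs to the Prüfer angle `θ`, with the weight `exp (σ ∫ d)`. -/
def amplitude (d : ℝ → ℝ) (σ : ℝ) (θ : ℝ → ℝ) (x : ℝ) : ℝ :=
  Real.exp (∫ t in (0 : ℝ)..x, d t * (σ + Real.cos (2 * θ t) / 3))

/-- Integration by parts in abstract form: when `2 s a` is a derivative up to a bounded remainder,
its integral gains a factor `1 / |s|`. -/
theorem abs_two_mul_integral_le {s B x : ℝ} (hx : 0 ≤ x) {f a b : ℝ → ℝ} (ha : Continuous a)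
    (hb : Continuous b) (hf : Continuous f)
    (hD : ∀ t ∈ Ioo 0 x, HasDerivAt f (2 * s * a t + b t) t) (hB : ∀ t, |b t| ≤ B) :
    |2 * s * ∫ t in (0 : ℝ)..x, a t| ≤ |f x - f 0| + B * x := by
  have h1 := intervalIntegral.integral_eq_sub_of_hasDerivAt_of_le hx hf.continuousOn hD
    ((by fun_prop : Continuous fun t => 2 * s * a t + b t).intervalIntegrable _ _)
  rw [intervalIntegral.integral_add ((ha.const_mul (2 * s)).intervalIntegrable _ _)
    (hb.intervalIntegrable _ _), intervalIntegral.integral_const_mul] at h1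
  have h2 : |∫ t in (0 : ℝ)..x, b t| ≤ B * x := by
    have := intervalIntegral.norm_integral_le_of_norm_le_const (a := 0) (b := x) (f := b) (C := B)
      (fun t _ => hB t)
    rwa [Real.norm_eq_abs, sub_zero, abs_of_nonneg hx] at this
  rw [show 2 * s * ∫ t in (0 : ℝ)..x, a t = (f x - f 0) - ∫ t in (0 : ℝ)..x, b t by linarith]
  exact (abs_sub _ _).trans (by linarith)

section Coefficient

variable {L γ s : ℝ} {d θ : ℝ → ℝ}

theorem IsCoefficient.abs_apply_le (hd : IsCoefficient L γ d) (x : ℝ) : |d x| ≤ 3 / 2 * γ := by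
  have := hd.ge x
  have := hd.le x
  rw [abs_le]
  constructor <;> linarith

theorem IsCoefficient.gamma_nonneg (hd : IsCoefficient L γ d) : 0 ≤ γ := by
  linarith [(abs_nonneg _).trans (hd.abs_apply_le 0)]

theorem IsPruefer.hasDerivAt_two_mul (h : IsPruefer L d s θ) {x : ℝ} (hx : x ∈ Icc 0 L) :
    HasDerivAt (fun x => 2 * θ x) (2 * (s - d x / 3 * Real.sin (2 * θ x))) x :=
  (h.hasDerivAt x hx).const_mul 2

/-- The derivative of `d sin 2θ` is `2 s d cos 2θ` plus terms quadratic in `d`, because `d' = -(2/3)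
d²`. The boundary term at `0` vanishes. -/
theorem IsCoefficient.abs_integral_cos_le (hd : IsCoefficient L γ d) (hγ : γ * L ≤ 1 / 4)
    (h : IsPruefer L d s θ) (hs : s ≠ 0) {x : ℝ} (hx : x ∈ Icc 0 L) :
    |∫ t in (0 : ℝ)..x, d t * Real.cos (2 * θ t)| ≤ 3 / 2 * γ / |s| := by
  have hc := hd.continuous
  have hθ := h.continuous
  have h0 := hd.gamma_nonneg
  have h1 := abs_two_mul_integral_le (s := s) (B := 3 * γ ^ 2) hx.1
    (f := fun t => d t * Real.sin (2 * θ t))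
    (a := fun t => d t * Real.cos (2 * θ t))
    (b := fun t => -(2 / 3) * d t ^ 2 * (Real.sin (2 * θ t) * (1 + Real.cos (2 * θ t))))
    (by fun_prop) (by fun_prop) (by fun_prop) ?_ ?_
  · simp only [h.zero, mul_zero, Real.sin_zero, sub_zero] at h1
    have h2 : |d x * Real.sin (2 * θ x)| ≤ 3 / 2 * γ * 1 := by
      rw [abs_mul]
      exact mul_le_mul (hd.abs_apply_le x) (Real.abs_sin_le_one _) (abs_nonneg _) (by positivity)
    rw [le_div_iff₀ (abs_pos.2 hs)]
    rw [abs_mul, abs_mul, abs_two] at h1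
    have h3 : γ * x ≤ 1 / 4 := (mul_le_mul_of_nonneg_left hx.2 h0).trans hγ
    nlinarith
  · intro t ht
    have ht' : t ∈ Ioo 0 L := ⟨ht.1, ht.2.trans_le hx.2⟩
    convert! (hd.hasDerivAt t ht').mul (h.hasDerivAt_two_mul (Ioo_subset_Icc_self ht')).sin using 1
    ring
  · intro t
    have h2 := hd.abs_apply_le t
    have h3 : |Real.sin (2 * θ t) * (1 + Real.cos (2 * θ t))| ≤ 1 * 2 := by
      rw [abs_mul]
      refine mul_le_mul (Real.abs_sin_le_one _) ?_ (abs_nonneg _) zero_le_one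
      rw [abs_le]
      constructor <;> linarith [Real.neg_one_le_cos (2 * θ t), Real.cos_le_one (2 * θ t)]
    have h4 : d t ^ 2 ≤ (3 / 2 * γ) ^ 2 := sq_le_sq' (by linarith [hd.ge t]) (le_of_abs_le h2)
    have h5 : |-(2 / 3) * d t ^ 2| = 2 / 3 * d t ^ 2 := by
      rw [neg_mul, abs_neg, abs_of_nonneg (by positivity)]
    rw [abs_mul, h5]
    calc _ ≤ 2 / 3 * (3 / 2 * γ) ^ 2 * (1 * 2) := by gcongr
      _ = _ := by ring

/-- Here the primitive is `-d cos 2θ`, whose boundary terms survive at both ends; hence a constant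
twice that of the cosine integral. -/
theorem IsCoefficient.abs_integral_sin_le (hd : IsCoefficient L γ d) (hγ : γ * L ≤ 1 / 4)
    (h : IsPruefer L d s θ) (hs : s ≠ 0) {x : ℝ} (hx : x ∈ Icc 0 L) :
    |∫ t in (0 : ℝ)..x, d t * Real.sin (2 * θ t)| ≤ 3 * γ / |s| := by
  have hc := hd.continuous
  have hθ := h.continuous
  have h0 := hd.gamma_nonneg
  have h1 := abs_two_mul_integral_le (s := s) (B := 3 * γ ^ 2) hx.1
    (f := fun t => -(d t * Real.cos (2 * θ t)))
    (a := fun t => d t * Real.sin (2 * θ t))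
    (b := fun t => -(2 / 3) * d t ^ 2 * (Real.sin (2 * θ t) ^ 2 - Real.cos (2 * θ t)))
    (by fun_prop) (by fun_prop) (by fun_prop) ?_ ?_
  · have h2 : ∀ t, |d t * Real.cos (2 * θ t)| ≤ 3 / 2 * γ * 1 := by
      intro t
      rw [abs_mul]
      exact mul_le_mul (hd.abs_apply_le t) (Real.abs_cos_le_one _) (abs_nonneg _) (by positivity)
    have h4 : |-(d x * Real.cos (2 * θ x)) - -(d 0 * Real.cos (2 * θ 0))| ≤ 3 * γ := by
      refine (abs_sub _ _).trans ?_
      rw [abs_neg, abs_neg]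
      linarith [h2 x, h2 0]
    rw [le_div_iff₀ (abs_pos.2 hs)]
    rw [abs_mul, abs_mul, abs_two] at h1
    have h3 : γ * x ≤ 1 / 4 := (mul_le_mul_of_nonneg_left hx.2 h0).trans hγ
    nlinarith
  · intro t ht
    have ht' : t ∈ Ioo 0 L := ⟨ht.1, ht.2.trans_le hx.2⟩
    convert!
      ((hd.hasDerivAt t ht').mul (h.hasDerivAt_two_mul (Ioo_subset_Icc_self ht')).cos).neg using 1
    ring
  · intro t
    have h2 := hd.abs_apply_le t
    have h3 : |Real.sin (2 * θ t) ^ 2 - Real.cos (2 * θ t)| ≤ 2 := by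
      rw [abs_le]
      constructor <;> nlinarith [Real.neg_one_le_cos (2 * θ t), Real.cos_le_one (2 * θ t),
        Real.sin_sq_add_cos_sq (2 * θ t), sq_nonneg (Real.cos (2 * θ t)),
        sq_nonneg (Real.sin (2 * θ t))]
    have h4 : d t ^ 2 ≤ (3 / 2 * γ) ^ 2 := sq_le_sq' (by linarith [hd.ge t]) (le_of_abs_le h2)
    have h5 : |-(2 / 3) * d t ^ 2| = 2 / 3 * d t ^ 2 := by
      rw [neg_mul, abs_neg, abs_of_nonneg (by positivity)]
    rw [abs_mul, h5]
    calc _ ≤ 2 / 3 * (3 / 2 * γ) ^ 2 * 2 := by gcongr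
      _ = _ := by ring

theorem IsPruefer.sub_mul_eq (h : IsPruefer L d s θ) (hc : Continuous d) {x : ℝ}
    (hx : x ∈ Icc 0 L) :
    θ x - s * x = -(1 / 3) * ∫ t in (0 : ℝ)..x, d t * Real.sin (2 * θ t) := by
  have hθ := h.continuous
  have h1 := intervalIntegral.integral_eq_sub_of_hasDerivAt (a := 0) (b := x)
    (f := fun x => θ x - s * x) (f' := fun t => -(1 / 3) * (d t * Real.sin (2 * θ t)))
    (fun t ht => ?_) ((by fun_prop : Continuous _).intervalIntegrable _ _)
  · rw [intervalIntegral.integral_const_mul] at h1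
    simp only [h.zero, mul_zero, sub_zero] at h1
    exact h1.symm
  · rw [uIcc_of_le hx.1] at ht
    convert! (h.hasDerivAt t ⟨ht.1, ht.2.trans hx.2⟩).sub ((hasDerivAt_id t).const_mul s) using 1
    ring

/-- The free phase `π n x / L`. -/
def phase (L : ℝ) (n : ℤ) (x : ℝ) : ℝ := Real.pi * n * x / L

theorem IsCoefficient.abs_sub_spectral_le (hd : IsCoefficient L γ d) (hL : 0 < L)
    (h : IsPruefer L d s θ) {n : ℤ} (hn : θ L = Real.pi * n) :
    |s - Real.pi * n / L| ≤ γ / 2 := by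
  have h1 := h.abs_sub_mul_le hd.abs_apply_le (right_mem_Icc.2 hL.le)
  rw [hn, show Real.pi * n - s * L = -((s - Real.pi * n / L) * L) by field_simp; ring, abs_neg,
    abs_mul, abs_of_pos hL] at h1
  have := le_of_mul_le_mul_right h1 hL
  linarith

/-- The value `π |n| / L` is perturbed by at most `γ / 2 ≤ |n| / (8 L)`, which fits in the gaps
between `3`, `π` and `4`. -/
theorem IsCoefficient.mul_abs_le (hd : IsCoefficient L γ d) (hL : 0 < L) (hγ : γ * L ≤ 1 / 4)
    (h : IsPruefer L d s θ) {n : ℤ} (hn : θ L = Real.pi * n) (h0 : n ≠ 0) :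
    3 * |(n : ℝ)| / L ≤ |s| ∧ |s| ≤ 4 * |(n : ℝ)| / L := by
  have h1 := hd.abs_sub_spectral_le hL h hn
  have h2 : |Real.pi * n / L| = Real.pi * |(n : ℝ)| / L := by
    rw [abs_div, abs_mul, abs_of_pos Real.pi_pos, abs_of_pos hL]
  have h3 := abs_sub_abs_le_abs_sub (Real.pi * n / L) s
  have h4 := abs_sub_abs_le_abs_sub s (Real.pi * n / L)
  rw [abs_sub_comm] at h3
  have h5 : (1 : ℝ) ≤ |(n : ℝ)| := by exact_mod_cast Int.one_le_abs h0
  have h6 := Real.pi_gt_d2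
  have h7 := Real.pi_lt_d2
  have h8 : γ / 2 ≤ (1 / 8) * |(n : ℝ)| / L := by
    rw [le_div_iff₀ hL]
    linarith
  have h9 : |Real.pi * n / L| - γ / 2 ≤ |s| := by linarith
  have h10 : |s| ≤ |Real.pi * n / L| + γ / 2 := by linarith
  rw [h2] at h9 h10
  constructor
  · refine le_trans ?_ h9
    refine le_trans ?_ (sub_le_sub_left h8 _)
    rw [← sub_div]
    gcongr
    nlinarith
  · refine h10.trans ((add_le_add_right h8 _).trans ?_)
    rw [← add_div]
    gcongr
    nlinarith

theorem IsCoefficient.abs_angle_sub_phase_le (hd : IsCoefficient L γ d) (hL : 0 < L)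
    (h : IsPruefer L d s θ) {n : ℤ} (hn : θ L = Real.pi * n) {x : ℝ} (hx : x ∈ Icc 0 L) :
    |θ x - phase L n x| ≤ γ * L := by
  have h1 := h.abs_sub_mul_le hd.abs_apply_le hx
  have h2 := hd.abs_sub_spectral_le hL h hn
  have h3 : θ x - phase L n x = (θ x - s * x) + (s - Real.pi * n / L) * x := by
    rw [phase]; ring
  rw [h3]
  refine (abs_add_le _ _).trans ?_
  rw [abs_mul, abs_of_nonneg hx.1]
  nlinarith [hx.1, hx.2, hd.gamma_nonneg]

theorem IsCoefficient.abs_angle_sub_phase_le_div (hd : IsCoefficient L γ d) (hL : 0 < L)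
    (hγ : γ * L ≤ 1 / 4) (h : IsPruefer L d s θ) {n : ℤ} (hn : θ L = Real.pi * n) (h0 : n ≠ 0)
    {x : ℝ} (hx : x ∈ Icc 0 L) : |θ x - phase L n x| ≤ γ * L / |(n : ℝ)| := by
  have hs := (hd.mul_abs_le hL hγ h hn h0).1
  have hn0 : 0 < |(n : ℝ)| := by positivity
  have hs0 : 0 < |s| := lt_of_lt_of_le (by positivity) hs
  have key : ∀ y ∈ Icc 0 L, |θ y - s * y| ≤ γ * L / |(n : ℝ)| / 3 := by
    intro y hy
    have h1 := hd.abs_integral_sin_le hγ h (abs_pos.1 hs0) hy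
    rw [h.sub_mul_eq hd.continuous hy, abs_mul, show |(-(1 / 3) : ℝ)| = 1 / 3 by norm_num]
    have h2 : 3 * γ / |s| ≤ γ * L / |(n : ℝ)| := by
      rw [div_le_div_iff₀ hs0 hn0]
      rw [div_le_iff₀ hL] at hs
      nlinarith [hd.gamma_nonneg]
    linarith
  have h1 := key x hx
  have h2 := key L (right_mem_Icc.2 hL.le)
  -- The phase is `s x` corrected by the linear interpolation of the end defect `θ L - s L`, so both
  -- terms are controlled by the same oscillatory integral.
  have h3 : θ x - phase L n x = (θ x - s * x) - (θ L - s * L) * (x / L) := by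
    rw [phase, hn]; field_simp; ring
  have h4 : |x / L| ≤ 1 := by
    rw [abs_div, abs_of_nonneg hx.1, abs_of_pos hL]
    exact (div_le_one hL).2 hx.2
  rw [h3]
  refine (abs_sub _ _).trans ?_
  rw [abs_mul]
  have h5 := mul_le_mul h2 h4 (abs_nonneg _) ((abs_nonneg _).trans h2)
  linarith [(abs_nonneg _).trans h2]

theorem continuous_log_amplitude (hc : Continuous d) (hθ : Continuous θ) (σ : ℝ) :
    Continuous fun t => d t * (σ + Real.cos (2 * θ t) / 3) := by fun_prop

theorem hasDerivAt_amplitude (hc : Continuous d) (hθ : Continuous θ) (σ x : ℝ) :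
    HasDerivAt (amplitude d σ θ)
      (d x * (σ + Real.cos (2 * θ x) / 3) * amplitude d σ θ x) x := by
  have h := continuous_log_amplitude hc hθ σ
  rw [mul_comm]
  exact (intervalIntegral.integral_hasDerivAt_right (h.intervalIntegrable 0 x)
      (h.stronglyMeasurableAtFilter _ _) h.continuousAt).exp

theorem amplitude_pos (d θ : ℝ → ℝ) (σ x : ℝ) : 0 < amplitude d σ θ x := Real.exp_pos _

theorem amplitude_zero (d θ : ℝ → ℝ) (σ : ℝ) : amplitude d σ θ 0 = 1 := by simp [amplitude]

theorem continuous_amplitude (hc : Continuous d) (hθ : Continuous θ) (σ : ℝ) :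
    Continuous (amplitude d σ θ) :=
  continuous_iff_continuousAt.2 fun x => (hasDerivAt_amplitude hc hθ σ x).continuousAt

/-- The logarithm of the amplitude is affine in `σ`. For `σ = -1` and `τ = 1` the weights cancel,
which evaluates the pairing of `ψ_n` with `χ_n`. -/
theorem amplitude_mul_amplitude (hc : Continuous d) (hθ : Continuous θ) (σ τ x : ℝ) :
    amplitude d σ θ x * amplitude d τ θ x = amplitude d ((σ + τ) / 2) θ x ^ 2 := by
  rw [amplitude, amplitude, amplitude, ← Real.exp_add, ← Real.exp_nat_mul,
    ← intervalIntegral.integral_add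
      ((continuous_log_amplitude hc hθ σ).intervalIntegrable _ _)
      ((continuous_log_amplitude hc hθ τ).intervalIntegrable _ _),
    ← intervalIntegral.integral_const_mul]
  congr 2
  ext t
  push_cast
  ring

theorem IsCoefficient.abs_log_amplitude_le (hd : IsCoefficient L γ d) {σ : ℝ} (hσ : |σ| ≤ 1)
    {x : ℝ} (hx : x ∈ Icc 0 L) :
    |∫ t in (0 : ℝ)..x, d t * (σ + Real.cos (2 * θ t) / 3)| ≤ 2 * (γ * L) := by
  have h1 := intervalIntegral.norm_integral_le_of_norm_le_const (a := 0) (b := x)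
    (f := fun t => d t * (σ + Real.cos (2 * θ t) / 3)) (C := 2 * γ) (fun t _ => ?_)
  · rw [Real.norm_eq_abs, sub_zero, abs_of_nonneg hx.1] at h1
    nlinarith [hx.2, hd.gamma_nonneg]
  · rw [Real.norm_eq_abs, abs_mul]
    have h2 : |σ + Real.cos (2 * θ t) / 3| ≤ 4 / 3 := by
      have h3 := abs_le.1 hσ
      rw [abs_le]
      constructor <;> linarith [Real.neg_one_le_cos (2 * θ t), Real.cos_le_one (2 * θ t)]
    have := mul_le_mul (hd.abs_apply_le t) h2 (abs_nonneg _) (by linarith [hd.gamma_nonneg])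
    linarith

theorem abs_exp_sub_one_le_two_mul {y b : ℝ} (hy : |y| ≤ b) (hb : b ≤ 1) :
    |Real.exp y - 1| ≤ 2 * b :=
  (Real.abs_exp_sub_one_le (hy.trans hb)).trans (by linarith)

theorem IsCoefficient.abs_amplitude_sub_one_le (hd : IsCoefficient L γ d) (hγ : γ * L ≤ 1 / 4)
    {σ : ℝ} (hσ : |σ| ≤ 1) {x : ℝ} (hx : x ∈ Icc 0 L) :
    |amplitude d σ θ x - 1| ≤ 4 * (γ * L) := by
  have := abs_exp_sub_one_le_two_mul (hd.abs_log_amplitude_le (θ := θ) hσ hx) (by linarith)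
  rw [amplitude]
  linarith

/-- The decay in `n` is particular to `σ = 0`: only then is the exponent a purely oscillatory
integral. -/
theorem IsCoefficient.abs_amplitude_sub_one_le_div (hd : IsCoefficient L γ d) (hL : 0 < L)
    (hγ : γ * L ≤ 1 / 4) (h : IsPruefer L d s θ) {n : ℤ} (hn : θ L = Real.pi * n) (h0 : n ≠ 0)
    {x : ℝ} (hx : x ∈ Icc 0 L) : |amplitude d 0 θ x - 1| ≤ γ * L / |(n : ℝ)| := by
  have hs := (hd.mul_abs_le hL hγ h hn h0).1
  have hn0 : 1 ≤ |(n : ℝ)| := by exact_mod_cast Int.one_le_abs h0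
  have hs0 : 0 < |s| := lt_of_lt_of_le (by positivity) hs
  have h1 := hd.abs_integral_cos_le hγ h (abs_pos.1 hs0) hx
  have h2 : 3 / 2 * γ / |s| ≤ γ * L / |(n : ℝ)| := by
    rw [div_le_div_iff₀ hs0 (by linarith)]
    rw [div_le_iff₀ hL] at hs
    nlinarith [hd.gamma_nonneg]
  have h3 : ∫ t in (0 : ℝ)..x, d t * (0 + Real.cos (2 * θ t) / 3) =
      1 / 3 * ∫ t in (0 : ℝ)..x, d t * Real.cos (2 * θ t) := by
    rw [← intervalIntegral.integral_const_mul]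
    congr 1
    ext t
    ring
  have h5 : γ * L / |(n : ℝ)| ≤ 1 := by
    rw [div_le_one (by linarith)]
    linarith
  have h4 : |∫ t in (0 : ℝ)..x, d t * (0 + Real.cos (2 * θ t) / 3)| ≤ γ * L / |(n : ℝ)| / 3 := by
    rw [h3, abs_mul, abs_of_pos (show (0 : ℝ) < 1 / 3 by norm_num)]
    linarith
  have h6 := abs_exp_sub_one_le_two_mul h4 (by linarith)
  rw [amplitude]
  linarith [(abs_nonneg _).trans (h1.trans h2)]

end Coefficient

/-! ### Polar functions and their pairings -/

/-- The function `(r e^{iθ}, -r e^{-iθ})`. -/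
def polar (r θ : ℝ → ℝ) (x : ℝ) : C2 :=
  !₂[(r x : ℂ) * Complex.exp (Complex.I * θ x), -((r x : ℂ) * Complex.exp (-(Complex.I * θ x)))]

theorem psi0_eq_polar (L : ℝ) (n : ℤ) : psi0 L n = polar (fun _ => 1) (phase L n) := by
  ext x i
  have h : Complex.I * (Real.pi : ℂ) * (n : ℂ) * (x : ℂ) / (L : ℂ) =
      Complex.I * (phase L n x : ℝ) := by
    simp only [phase]
    push_cast
    ring
  fin_cases i <;> simp [psi0, polar, h]

theorem conj_exp_I_mul (t : ℝ) :
    conj (Complex.exp (Complex.I * t)) = Complex.exp (-(Complex.I * t)) := by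
  rw [← Complex.exp_conj]
  simp

theorem conj_exp_neg_I_mul (t : ℝ) :
    conj (Complex.exp (-(Complex.I * t))) = Complex.exp (Complex.I * t) := by
  rw [← Complex.exp_conj]
  simp

/-- For real amplitudes and angles the two components contribute conjugate exponentials, which add
up to a cosine; the factor `2` turns `1 / (2 L)` into `1 / L`. -/
theorem pairing_smul_polar (L : ℝ) (α β : ℂ) (r θ r' θ' : ℝ → ℝ) :
    pairing L (fun x => α • polar r θ x) (fun x => β • polar r' θ' x) =
      α * conj β * ((1 / L * ∫ x in (0 : ℝ)..L, r x * r' x * Real.cos (θ x - θ' x) : ℝ) : ℂ) := by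
  have h : ∀ x : ℝ, (α • polar r θ x) 0 * conj ((β • polar r' θ' x) 0) +
      (α • polar r θ x) 1 * conj ((β • polar r' θ' x) 1) =
      (2 * (α * conj β)) * ((r x * r' x * Real.cos (θ x - θ' x) : ℝ) : ℂ) := by
    intro x
    simp only [polar, PiLp.smul_apply, smul_eq_mul, map_mul, map_neg, Complex.conj_ofReal,
      Matrix.cons_val_zero, Matrix.cons_val_one, conj_exp_I_mul, conj_exp_neg_I_mul]
    push_cast
    rw [Complex.cos, show ((θ x : ℂ) - θ' x) * Complex.I = Complex.I * θ x + -(Complex.I * θ' x) by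
      ring, show -((θ x : ℂ) - θ' x) * Complex.I = -(Complex.I * θ x) + Complex.I * θ' x by ring,
      Complex.exp_add, Complex.exp_add]
    ring
  simp only [pairing, h]
  rw [intervalIntegral.integral_const_mul, intervalIntegral.integral_ofReal]
  push_cast
  ring

theorem pairing_smul_polar_controlProfile (L : ℝ) (β : ℂ) (r θ : ℝ → ℝ) :
    pairing L (fun x => β • polar r θ x) controlProfile =
      β * Complex.I * ((1 / L * ∫ x in (0 : ℝ)..L, r x * Real.sin (θ x) : ℝ) : ℂ) := by
  have h : ∀ x : ℝ, (β • polar r θ x) 0 * conj (controlProfile x 0) +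
      (β • polar r θ x) 1 * conj (controlProfile x 1) =
      (2 * (β * Complex.I)) * ((r x * Real.sin (θ x) : ℝ) : ℂ) := by
    intro x
    simp only [polar, controlProfile, PiLp.smul_apply, smul_eq_mul, map_one,
      Matrix.cons_val_zero, Matrix.cons_val_one]
    push_cast
    rw [Complex.sin, show (θ x : ℂ) * Complex.I = Complex.I * θ x by ring,
      show -(θ x : ℂ) * Complex.I = -(Complex.I * θ x) by ring]
    linear_combination (β * r x * (Complex.exp (Complex.I * θ x) -
      Complex.exp (-(Complex.I * θ x)))) * Complex.I_sq
  simp only [pairing, h]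
  rw [intervalIntegral.integral_const_mul, intervalIntegral.integral_ofReal]
  push_cast
  ring

theorem continuous_polar {r θ : ℝ → ℝ} (hr : Continuous r) (hθ : Continuous θ) :
    Continuous (polar r θ) := by
  unfold polar
  fun_prop

theorem norm_polar_sub_sq_le (r θ φ : ℝ → ℝ) (x : ℝ) :
    ‖polar r θ x - polar (fun _ => 1) φ x‖ ^ 2 ≤ 2 * (|r x - 1| + |θ x - φ x|) ^ 2 := by
  have h1 : ∀ a b c : ℝ, ‖(a : ℂ) * Complex.exp (Complex.I * b) - Complex.exp (Complex.I * c)‖ ≤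
      |a - 1| + |b - c| := by
    intro a b c
    have h2 : (a : ℂ) * Complex.exp (Complex.I * b) - Complex.exp (Complex.I * c) =
        ((a - 1 : ℝ) : ℂ) * Complex.exp (Complex.I * b) +
          Complex.exp (Complex.I * c) * (Complex.exp (Complex.I * (b - c : ℝ)) - 1) := by
      rw [mul_sub (Complex.exp _), ← Complex.exp_add]
      push_cast
      ring_nf
    rw [h2]
    refine (norm_add_le _ _).trans (add_le_add ?_ ?_)
    · rw [norm_mul, Complex.norm_real, Real.norm_eq_abs, Complex.norm_exp_I_mul_ofReal, mul_one]
    · rw [norm_mul, Complex.norm_exp_I_mul_ofReal, one_mul]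
      exact Real.norm_exp_I_mul_ofReal_sub_one_le
  have h2 := h1 (r x) (θ x) (φ x)
  have h3 := h1 (r x) (-θ x) (-φ x)
  rw [show |-θ x - -φ x| = |θ x - φ x| by rw [neg_sub_neg, abs_sub_comm]] at h3
  rw [EuclideanSpace.norm_sq_eq, Fin.sum_univ_two]
  simp only [polar, PiLp.sub_apply, Matrix.cons_val_zero, Matrix.cons_val_one, Complex.ofReal_one,
    one_mul]
  rw [neg_sub_neg, norm_sub_rev (Complex.exp (-(Complex.I * φ x)))]
  push_cast at h3
  rw [mul_neg, mul_neg] at h3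
  have h4 := pow_le_pow_left₀ (norm_nonneg _) h2 2
  have h5 := pow_le_pow_left₀ (norm_nonneg _) h3 2
  linarith

/-! ### The space `L²`, Parseval's identity and completeness -/

theorem memLp_of_continuous {E : Type*} [NormedAddCommGroup E] {f : ℝ → E} (L : ℝ)
    (hf : Continuous f) [SecondCountableTopology E] :
    MemLp f 2 (volume.restrict (Ioo (0 : ℝ) L)) := by
  obtain ⟨C, hC⟩ := (isCompact_Icc (a := (0 : ℝ)) (b := L)).exists_bound_of_continuousOn
    hf.continuousOn
  refine MemLp.of_bound hf.aestronglyMeasurable C ?_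
  filter_upwards [ae_restrict_mem measurableSet_Ioo] with x hx
  exact hC x (Ioo_subset_Icc_self hx)

theorem inner_toLp_toLp {L : ℝ} (hL : 0 < L) {f g : ℝ → C2}
    (hf : MemLp f 2 (volume.restrict (Ioo (0 : ℝ) L)))
    (hg : MemLp g 2 (volume.restrict (Ioo (0 : ℝ) L))) :
    inner ℂ (hf.toLp f) (hg.toLp g) = 2 * L * pairing L g f := by
  rw [L2.inner_def, pairing, intervalIntegral.integral_of_le hL.le, integral_Ioc_eq_integral_Ioo,
    ← mul_assoc, mul_one_div_cancel (by exact_mod_cast (by positivity : (2 * L : ℝ) ≠ 0)), one_mul]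
  refine integral_congr_ae ?_
  filter_upwards [hf.coeFn_toLp, hg.coeFn_toLp] with x h1 h2
  rw [h1, h2, PiLp.inner_apply, Fin.sum_univ_two]
  simp

theorem norm_sq_eq_integral {L : ℝ} (F : L2Space L) : ‖F‖ ^ 2 = ∫ x in Ioo 0 L, ‖F x‖ ^ 2 := by
  have h2 : inner ℂ F F = ((∫ x in Ioo 0 L, ‖F x‖ ^ 2 : ℝ) : ℂ) := by
    rw [L2.inner_def, ← integral_complex_ofReal]
    refine integral_congr_ae (ae_of_all _ fun x => ?_)
    simp only [inner_self_eq_norm_sq_to_K]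
    simp
  rw [inner_self_eq_norm_sq_to_K] at h2
  exact Complex.ofReal_injective (by simpa using h2)

theorem norm_toLp_sq_le {L C : ℝ} (hL : 0 < L) {f : ℝ → C2}
    (hf : MemLp f 2 (volume.restrict (Ioo (0 : ℝ) L))) (hC : ∀ x ∈ Ioo 0 L, ‖f x‖ ^ 2 ≤ C) :
    ‖hf.toLp f‖ ^ 2 ≤ C * L := by
  have h1 : ‖hf.toLp f‖ ^ 2 = ∫ x in Ioo 0 L, ‖f x‖ ^ 2 := by
    rw [norm_sq_eq_integral]
    refine integral_congr_ae ?_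
    filter_upwards [hf.coeFn_toLp] with x h1
    rw [h1]
  rw [h1]
  have h3 := setIntegral_mono_on (μ := volume) (s := Ioo 0 L)
    ((memLp_two_iff_integrable_sq_norm hf.1).1 hf) (integrable_const C) measurableSet_Ioo hC
  simpa [hL.le, mul_comm] using h3

/-- Reflecting the second component to the negative half-line turns a pair of functions on `(0, L)`
into one function on `(-L, L)`, where classical Fourier series apply. -/
theorem integral_fold {E : Type*} [NormedAddCommGroup E] [NormedSpace ℝ E] {L : ℝ} (hL : 0 ≤ L)
    {f g h : ℝ → E} (hf : IntervalIntegrable f volume 0 L) (hg : IntervalIntegrable g volume 0 L)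
    (hp : ∀ x, 0 < x → h x = f x) (hn : ∀ x, x ≤ 0 → h x = g (-x)) :
    IntervalIntegrable h volume (-L) L ∧
      ∫ x in -L..L, h x = (∫ x in (0 : ℝ)..L, f x) + ∫ x in (0 : ℝ)..L, g x := by
  have hp' : ∀ x ∈ uIoc 0 L, f x = h x := fun x hx => by
    rw [uIoc_of_le hL] at hx
    exact (hp x hx.1).symm
  have hn' : ∀ x ∈ uIoc (-L) 0, g (-x) = h x := fun x hx => by
    rw [uIoc_of_le (by linarith)] at hx
    exact (hn x hx.2).symm
  have hg' : IntervalIntegrable (fun x => g (-x)) volume (-L) 0 := by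
    have := hg.comp_sub_left 0
    simpa using this.symm
  have h1 : IntervalIntegrable h volume 0 L := hf.congr hp'
  have h2 : IntervalIntegrable h volume (-L) 0 := hg'.congr hn'
  refine ⟨h2.trans h1, ?_⟩
  rw [← intervalIntegral.integral_add_adjacent_intervals h2 h1, add_comm]
  congr 1
  · exact (intervalIntegral.integral_congr_ae (ae_of_all _ hp')).symm
  · rw [← intervalIntegral.integral_congr_ae (ae_of_all _ hn'), intervalIntegral.integral_comp_neg]
    simp

/-- **Parseval's identity** for the eigenfunctions `psi0 L n`. -/
theorem hasSum_norm_inner_psi0_sq {L : ℝ} (hL : 0 < L)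
    (hp : ∀ n, MemLp (psi0 L n) 2 (volume.restrict (Ioo (0 : ℝ) L))) (F : L2Space L) :
    HasSum (fun n => ‖inner ℂ ((hp n).toLp (psi0 L n)) F‖ ^ 2) (2 * L * ‖F‖ ^ 2) := by
  have hFm : StronglyMeasurable F := Lp.stronglyMeasurable F
  have hF0 : StronglyMeasurable fun x => F x 0 :=
    (EuclideanSpace.proj (𝕜 := ℂ) (0 : Fin 2)).continuous.comp_stronglyMeasurable hFm
  have hF1 : StronglyMeasurable fun x => F x 1 :=
    (EuclideanSpace.proj (𝕜 := ℂ) (1 : Fin 2)).continuous.comp_stronglyMeasurable hFm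
  have hF := Lp.memLp F
  have hp0 : MemLp (fun x => F x 0) 2 (volume.restrict (Ioo (0 : ℝ) L)) :=
    hF.mono hF0.aestronglyMeasurable (ae_of_all _ fun x => PiLp.norm_apply_le _ _)
  have hp1 : MemLp (fun x => F x 1) 2 (volume.restrict (Ioo (0 : ℝ) L)) :=
    hF.mono hF1.aestronglyMeasurable (ae_of_all _ fun x => PiLp.norm_apply_le _ _)
  -- The minus sign matches the second component of `psi0`, so that `psi0 L n` folds to the
  -- character `e^{i π n x / L}` on `(-L, L)`.
  let G : ℝ → ℂ := fun x => if 0 < x then F x 0 else -F (-x) 1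
  have hGm : StronglyMeasurable G := by
    refine StronglyMeasurable.ite (measurableSet_Ioi (a := (0 : ℝ))) hF0 ?_
    exact (hF1.comp_measurable measurable_neg).neg
  have hii : ∀ {f : ℝ → ℝ}, Integrable f (volume.restrict (Ioo (0 : ℝ) L)) →
      IntervalIntegrable f volume 0 L := fun hf =>
    (intervalIntegrable_iff_integrableOn_Ioo_of_le hL.le).2 hf
  have hsq := integral_fold hL.le (h := fun x => ‖G x‖ ^ 2)
    (hii ((memLp_two_iff_integrable_sq_norm hp0.1).1 hp0))
    (hii ((memLp_two_iff_integrable_sq_norm hp1.1).1 hp1))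
    (fun x hx => by simp [G, hx]) (fun x hx => by simp [G, hx.not_gt])
  have hLL : -L < L := by linarith
  have hG : MemLp G 2 (volume.restrict (Ioc (-L) L)) :=
    (memLp_two_iff_integrable_sq_norm hGm.aestronglyMeasurable).2
      ((intervalIntegrable_iff_integrableOn_Ioc_of_le hLL.le).1 hsq.1)
  have hsum := hasSum_sq_fourierCoeffOn hLL hG
  have hnorm : ∫ x in -L..L, ‖G x‖ ^ 2 = ‖F‖ ^ 2 := by
    rw [hsq.2, ← intervalIntegral.integral_add
      (hii ((memLp_two_iff_integrable_sq_norm hp0.1).1 hp0))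
      (hii ((memLp_two_iff_integrable_sq_norm hp1.1).1 hp1)),
      intervalIntegral.integral_of_le hL.le, integral_Ioc_eq_integral_Ioo, norm_sq_eq_integral]
    refine integral_congr_ae (ae_of_all _ fun x => ?_)
    simp only [EuclideanSpace.norm_sq_eq, Fin.sum_univ_two]
  rw [hnorm, show L - -L = 2 * L by ring] at hsum
  have hcoef : ∀ n, inner ℂ ((hp n).toLp (psi0 L n)) F = 2 * L * fourierCoeffOn hLL G n := by
    intro n
    have hcont : ∀ c : ℝ, Continuous fun x : ℝ => Complex.exp (Complex.I * (c * x : ℝ)) := by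
      intro c
      fun_prop
    have hmul : ∀ (c : ℝ) {f : ℝ → ℂ}, MemLp f 2 (volume.restrict (Ioo (0 : ℝ) L)) →
        IntervalIntegrable (fun x : ℝ => Complex.exp (Complex.I * (c * x : ℝ)) * f x)
          volume 0 L := by
      intro c f hf
      have h1 : IntervalIntegrable f volume 0 L :=
        (intervalIntegrable_iff_integrableOn_Ioo_of_le hL.le).2 (hf.integrable (by norm_num))
      exact h1.continuousOn_mul (hcont c).continuousOn
    have hker : ∀ x : ℝ, (fourier (-n) (x : AddCircle (L - -L)) : ℂ) =
        Complex.exp (Complex.I * (-(Real.pi * n / L) * x : ℝ)) := by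
      intro x
      rw [fourier_coe_apply]
      congr 1
      have : (L : ℂ) ≠ 0 := by exact_mod_cast hL.ne'
      push_cast
      rw [show (L : ℂ) - -L = 2 * L by ring]
      field_simp
    have hfold := integral_fold hL.le
      (h := fun x : ℝ => Complex.exp (Complex.I * (-(Real.pi * n / L) * x : ℝ)) * G x)
      (hmul (-(Real.pi * n / L)) hp0) (hmul (Real.pi * n / L) hp1.neg)
      (fun x hx => by simp [G, hx]) (fun x hx => by simp [G, hx.not_gt])
    rw [fourierCoeffOn_eq_integral]
    simp only [hker, smul_eq_mul]
    rw [hfold.2, ← intervalIntegral.integral_add (hmul _ hp0) (hmul _ hp1.neg),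
      intervalIntegral.integral_of_le hL.le, integral_Ioc_eq_integral_Ioo, L2.inner_def]
    have h2 : ∀ z : ℂ, 2 * (L : ℂ) * ((1 / (L - -L)) • z) = z := by
      intro z
      have : (L : ℂ) ≠ 0 := by exact_mod_cast hL.ne'
      rw [Complex.real_smul, show L - -L = 2 * L by ring]
      push_cast
      field_simp
    rw [h2]
    refine integral_congr_ae ?_
    filter_upwards [(hp n).coeFn_toLp] with x h1
    rw [h1, psi0_eq_polar, PiLp.inner_apply, Fin.sum_univ_two]
    simp only [polar, phase, Matrix.cons_val_zero, Matrix.cons_val_one, RCLike.inner_apply,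
      Complex.ofReal_one, one_mul, map_neg, conj_exp_I_mul, conj_exp_neg_I_mul, Pi.neg_apply]
    push_cast
    ring_nf
  have h3 := hsum.mul_left ((2 * L) ^ 2)
  have h4 : (fun n => ‖inner ℂ ((hp n).toLp (psi0 L n)) F‖ ^ 2) =
      fun n => (2 * L) ^ 2 * ‖fourierCoeffOn hLL G n‖ ^ 2 := by
    ext n
    rw [hcoef, norm_mul, mul_pow, show (2 * L : ℂ) = ((2 * L : ℝ) : ℂ) by push_cast; rfl,
      Complex.norm_real, Real.norm_of_nonneg (by positivity)]
  have h5 : 2 * L * ‖F‖ ^ 2 = (2 * L) ^ 2 * ((2 * L)⁻¹ • ‖F‖ ^ 2) := by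
    rw [smul_eq_mul]
    field_simp
  rw [h4, h5]
  exact h3

/-- A family that is quadratically close to a Parseval frame is complete. -/
theorem eq_zero_of_inner_eq_zero {ι H : Type*} [NormedAddCommGroup H] [InnerProductSpace ℂ H]
    {c : ℝ} {e v : ι → H} (he : ∀ f, HasSum (fun i => ‖inner ℂ (e i) f‖ ^ 2) (c * ‖f‖ ^ 2))
    (hs : Summable fun i => ‖v i - e i‖ ^ 2) (hc : ∑' i, ‖v i - e i‖ ^ 2 < c) {f : H}
    (hf : ∀ i, inner ℂ (v i) f = 0) : f = 0 := by
  have h1 : ∀ i, ‖inner ℂ (e i) f‖ ^ 2 ≤ ‖v i - e i‖ ^ 2 * ‖f‖ ^ 2 := by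
    intro i
    -- For `f` orthogonal to all `v i`, the frame coefficients only see the differences `v i - e i`.
    -- Parseval then gives `c ‖f‖² ≤ (∑ ‖v i - e i‖²) ‖f‖²`, impossible for `f ≠ 0`.
    have h2 : inner ℂ (e i) f = -inner ℂ (v i - e i) f := by
      rw [inner_sub_left, hf i, zero_sub, neg_neg]
    rw [h2, norm_neg, ← mul_pow]
    exact pow_le_pow_left₀ (norm_nonneg _) (norm_inner_le_norm _ _) 2
  have h2 := (he f).tsum_eq ▸ (he f).summable.tsum_le_tsum h1 (hs.mul_right _)
  rw [tsum_mul_right] at h2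
  by_contra hne
  have h3 : 0 < ‖f‖ ^ 2 := by positivity
  nlinarith

/-! ### Eigenfunctions as solutions of a first order system -/

/-- Let `v` be a primitive of the continuous extension of `g`. Then `w - v` is absolutely continuous
with derivative zero almost everywhere, hence constant. Passing from `w` to `v` also removes any
dependence on `w` outside `[0, L]`. -/
theorem exists_hasDerivAt_of_absolutelyContinuous {L : ℝ} (hL : 0 ≤ L) {w g : ℝ → C2}
    (hw : AbsolutelyContinuousOnInterval w 0 L) (hg : ContinuousOn g (Icc 0 L))
    (h : ∀ᵐ x ∂(volume.restrict (Ioo (0 : ℝ) L)), deriv w x = g x) :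
    ∃ v : ℝ → C2, (∀ x ∈ Icc 0 L, v x = w x) ∧ ∀ x ∈ Icc 0 L, HasDerivAt v (g x) x := by
  let G : ℝ → C2 := fun x => g (projIcc 0 L hL x)
  have hG : Continuous G := hg.domRestrict.comp continuous_projIcc
  have hGg : ∀ x ∈ Icc 0 L, G x = g x := fun x hx => by simp [G, projIcc_of_mem hL hx]
  let v : ℝ → C2 := fun x => w 0 + ∫ t in (0 : ℝ)..x, G t
  have hv : ∀ x, HasDerivAt v (G x) x := fun x =>
    (intervalIntegral.integral_hasDerivAt_right (hG.intervalIntegrable 0 x)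
      (hG.stronglyMeasurableAtFilter _ _) hG.continuousAt).const_add _
  have hvAC : AbsolutelyContinuousOnInterval v 0 L := by
    refine ContDiffOn.absolutelyContinuousOnInterval (ContDiff.contDiffOn ?_)
    rw [contDiff_one_iff_deriv]
    refine ⟨fun x => (hv x).differentiableAt, ?_⟩
    rw [show deriv v = G from funext fun x => (hv x).deriv]
    exact hG
  have hdiff : ∀ᵐ x, x ∈ uIcc 0 L → DifferentiableAt ℝ w x :=
    hw.boundedVariationOn.ae_differentiableAt_of_mem_uIcc
  have hae : ∀ᵐ x, x ∈ uIcc 0 L → HasDerivAt (w - v) 0 x := by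
    rw [ae_restrict_iff' measurableSet_Ioo] at h
    have h0 : ∀ᵐ x : ℝ, x ≠ 0 := by simp [ae_iff]
    have h1 : ∀ᵐ x : ℝ, x ≠ L := by simp [ae_iff]
    filter_upwards [hdiff, h, h0, h1] with x hx1 hx2 hx3 hx4 hx
    have h2 := (hx1 hx).hasDerivAt.sub (hv x)
    rw [uIcc_of_le hL] at hx
    rwa [hx2 ⟨lt_of_le_of_ne hx.1 hx3.symm, lt_of_le_of_ne hx.2 hx4⟩, hGg x hx, sub_self] at h2
  obtain ⟨C, hC⟩ := (hw.sub hvAC).const_of_ae_hasDerivAt_zero hae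
  have hC0 := hC 0 left_mem_uIcc
  have hv0 : v 0 = w 0 := by simp [v]
  simp only [Pi.sub_apply, hv0, sub_self] at hC0
  refine ⟨v, fun x hx => ?_, fun x hx => hGg x hx ▸ hv x⟩
  have := hC x (by rwa [uIcc_of_le hL])
  rw [← hC0, Pi.sub_apply, sub_eq_zero] at this
  exact this.symm

/-- The right-hand side of the first order system to which the eigenvalue equations of the operator
(`σ = -1`) and of its adjoint (`σ = 1`) are equivalent. -/
def systemRhs (d : ℝ → ℝ) (σ : ℝ) (ζ : ℂ) (x : ℝ) (y : C2) : C2 :=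
  !₂[(ζ + σ * d x) * y 0 - d x / 3 * y 1, -(d x / 3) * y 0 + (-ζ + σ * d x) * y 1]

theorem S0_eq_smul_iff {L γ : ℝ} {w : ℝ → C2} {z : ℂ} {x : ℝ} :
    S0 L γ w x = z • w x ↔ deriv w x = systemRhs (delta L γ) (-1) z x (w x) := by
  have h1 : S0 L γ w x = z • w x ↔
      (deriv w x 0 + delta L γ x * (w x 0 + 1 / 3 * w x 1) = z * w x 0 ∧
        -deriv w x 1 + delta L γ x * (-(1 / 3) * w x 0 - w x 1) = z * w x 1) := by
    simp only [PiLp.ext_iff, Fin.forall_fin_two, S0, Lam, J0, PiLp.add_apply, PiLp.smul_apply,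
      Matrix.toLpLin_apply, Matrix.mulVec, dotProduct, Fin.sum_univ_two]
    simp [sub_eq_add_neg]
  have h2 : deriv w x = systemRhs (delta L γ) (-1) z x (w x) ↔
      (deriv w x 0 = (z + (-1 : ℝ) * delta L γ x) * w x 0 - delta L γ x / 3 * w x 1 ∧
        deriv w x 1 = -(delta L γ x / 3) * w x 0 + (-z + (-1 : ℝ) * delta L γ x) * w x 1) := by
    simp only [PiLp.ext_iff, Fin.forall_fin_two, systemRhs]
    simp
  rw [h1, h2]
  push_cast
  refine and_congr ⟨fun h => ?_, fun h => ?_⟩ ⟨fun h => ?_, fun h => ?_⟩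
  · linear_combination h
  · linear_combination h
  · linear_combination -h
  · linear_combination -h

theorem S0Adj_eq_smul_iff {L γ : ℝ} {w : ℝ → C2} {z : ℂ} {x : ℝ} :
    S0Adj L γ w x = z • w x ↔ deriv w x = systemRhs (delta L γ) 1 (-z) x (w x) := by
  have h1 : S0Adj L γ w x = z • w x ↔
      (-deriv w x 0 + delta L γ x * (w x 0 - 1 / 3 * w x 1) = z * w x 0 ∧
        deriv w x 1 + delta L γ x * (1 / 3 * w x 0 - w x 1) = z * w x 1) := by
    simp only [PiLp.ext_iff, Fin.forall_fin_two, S0Adj, Lam, J0, PiLp.add_apply, PiLp.smul_apply,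
      Matrix.toLpLin_apply, Matrix.mulVec, dotProduct, Fin.sum_univ_two]
    simp [sub_eq_add_neg, Matrix.vecHead, Matrix.vecTail]
  have h2 : deriv w x = systemRhs (delta L γ) 1 (-z) x (w x) ↔
      (deriv w x 0 = (-z + (1 : ℝ) * delta L γ x) * w x 0 - delta L γ x / 3 * w x 1 ∧
        deriv w x 1 = -(delta L γ x / 3) * w x 0 + (- -z + (1 : ℝ) * delta L γ x) * w x 1) := by
    simp only [PiLp.ext_iff, Fin.forall_fin_two, systemRhs]
    simp
  rw [h1, h2]
  push_cast
  refine and_congr ⟨fun h => ?_, fun h => ?_⟩ ⟨fun h => ?_, fun h => ?_⟩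
  · linear_combination -h
  · linear_combination -h
  · linear_combination h
  · linear_combination h

/-- Eigenfunctions of the first order system. -/
def IsSystemEigenfunction (L : ℝ) (d : ℝ → ℝ) (σ : ℝ) (ζ : ℂ) (w : ℝ → C2) : Prop :=
  MemDomain L w ∧ (∃ x ∈ Icc (0 : ℝ) L, w x ≠ 0) ∧
    ∀ᵐ x ∂(volume.restrict (Ioo (0 : ℝ) L)), deriv w x = systemRhs d σ ζ x (w x)

theorem systemRhs_congr {d d' : ℝ → ℝ} {σ : ℝ} {ζ : ℂ} {x : ℝ} (h : d x = d' x) (y : C2) :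
    systemRhs d σ ζ x y = systemRhs d' σ ζ x y := by
  simp only [systemRhs, h]

theorem isEigenfunction_S0_iff {L γ : ℝ} {d : ℝ → ℝ} (hd : ∀ x ∈ Icc 0 L, d x = delta L γ x)
    {z : ℂ} {w : ℝ → C2} :
    IsEigenfunction L (S0 L γ) z w ↔ IsSystemEigenfunction L d (-1) z w := by
  refine and_congr_right fun _ => and_congr_right fun _ => ?_
  refine ⟨fun h => ?_, fun h => ?_⟩
  all_goals
    filter_upwards [h, ae_restrict_mem measurableSet_Ioo] with x hx hx'
    have h1 := S0_eq_smul_iff (L := L) (γ := γ) (w := w) (z := z) (x := x)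
    rw [← systemRhs_congr (hd x (Ioo_subset_Icc_self hx'))] at h1
  · exact h1.1 hx
  · exact h1.2 hx

theorem isEigenfunction_S0Adj_iff {L γ : ℝ} {d : ℝ → ℝ} (hd : ∀ x ∈ Icc 0 L, d x = delta L γ x)
    {z : ℂ} {w : ℝ → C2} :
    IsEigenfunction L (S0Adj L γ) z w ↔ IsSystemEigenfunction L d 1 (-z) w := by
  refine and_congr_right fun _ => and_congr_right fun _ => ?_
  refine ⟨fun h => ?_, fun h => ?_⟩
  all_goals
    filter_upwards [h, ae_restrict_mem measurableSet_Ioo] with x hx hx'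
    have h1 := S0Adj_eq_smul_iff (L := L) (γ := γ) (w := w) (z := z) (x := x)
    rw [← systemRhs_congr (hd x (Ioo_subset_Icc_self hx'))] at h1
  · exact h1.1 hx
  · exact h1.2 hx

section System

variable {L s σ : ℝ} {d θ : ℝ → ℝ}

theorem continuousOn_systemRhs (hd : Continuous d) (ζ : ℂ) {w : ℝ → C2} {t : Set ℝ}
    (hw : ContinuousOn w t) : ContinuousOn (fun x => systemRhs d σ ζ x (w x)) t := by
  unfold systemRhs
  fun_prop

theorem hasDerivAt_C2 {f : ℝ → C2} {a b : ℂ} {x : ℝ} (h0 : HasDerivAt (fun x => f x 0) a x)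
    (h1 : HasDerivAt (fun x => f x 1) b x) : HasDerivAt f !₂[a, b] x := by
  have h : HasDerivAt (fun x i => f x i) ![a, b] x := by
    refine hasDerivAt_pi.2 fun i => ?_
    fin_cases i
    · exact h0
    · exact h1
  exact (PiLp.continuousLinearEquiv 2 ℝ fun _ : Fin 2 => ℂ).symm.hasFDerivAt.comp_hasDerivAt x h

theorem hasDerivAt_apply_C2 {f : ℝ → C2} {f' : C2} {x : ℝ} (h : HasDerivAt f f' x) (i : Fin 2) :
    HasDerivAt (fun x => f x i) (f' i) x :=
  ((EuclideanSpace.proj (𝕜 := ℂ) i).restrictScalars ℝ).hasFDerivAt.comp_hasDerivAt x h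

/-- The Prüfer substitution: the imaginary part of the logarithmic derivative of the first component
is the angle equation, the real part the amplitude equation. The second component is minus the
conjugate of the first. -/
theorem IsPruefer.hasDerivAt_polar (h : IsPruefer L d s θ) (hd : Continuous d) {x : ℝ}
    (hx : x ∈ Icc 0 L) :
    HasDerivAt (polar (amplitude d σ θ) θ)
      (systemRhs d σ (Complex.I * s) x (polar (amplitude d σ θ) θ x)) x := by
  have hr := (hasDerivAt_amplitude hd h.continuous σ x).ofReal_comp
  have hθ := ((h.hasDerivAt x hx).ofReal_comp).const_mul Complex.I
  have hc : Complex.cos (2 * θ x) = (Complex.exp (Complex.I * θ x) *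
      Complex.exp (Complex.I * θ x) +
        Complex.exp (-(Complex.I * θ x)) * Complex.exp (-(Complex.I * θ x))) / 2 := by
    rw [Complex.cos, ← Complex.exp_add, ← Complex.exp_add]
    ring_nf
  have hs : Complex.sin (2 * θ x) = (Complex.exp (-(Complex.I * θ x)) *
      Complex.exp (-(Complex.I * θ x)) -
        Complex.exp (Complex.I * θ x) * Complex.exp (Complex.I * θ x)) * Complex.I / 2 := by
    rw [Complex.sin, ← Complex.exp_add, ← Complex.exp_add]
    ring_nf
  have he : Complex.exp (Complex.I * θ x) * Complex.exp (-(Complex.I * θ x)) = 1 := by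
    rw [← Complex.exp_add, add_neg_cancel, Complex.exp_zero]
  refine hasDerivAt_C2 ?_ ?_
  · simp only [polar, Matrix.cons_val_zero, Matrix.cons_val_one]
    convert! hr.mul hθ.cexp using 1
    push_cast
    rw [hc, hs]
    generalize Complex.exp (Complex.I * θ x) = e at *
    generalize Complex.exp (-(Complex.I * θ x)) = e' at *
    linear_combination (d x * amplitude d σ θ x / 3 * e * (e' ^ 2 - e ^ 2) / 2) * Complex.I_sq -
      (d x * amplitude d σ θ x / 3 * e') * he
  · simp only [polar, Matrix.cons_val_zero, Matrix.cons_val_one]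
    convert! (hr.mul hθ.neg.cexp).neg using 1
    push_cast
    simp only [Pi.neg_apply]
    rw [hc, hs]
    generalize Complex.exp (Complex.I * θ x) = e at *
    generalize Complex.exp (-(Complex.I * θ x)) = e' at *
    linear_combination (d x * amplitude d σ θ x / 3 * e' * (e' ^ 2 - e ^ 2) / 2) * Complex.I_sq +
      (d x * amplitude d σ θ x / 3 * e) * he

theorem polar_ne_zero {r : ℝ → ℝ} (θ : ℝ → ℝ) {x : ℝ} (hr : r x ≠ 0) (i : Fin 2) :
    polar r θ x i ≠ 0 := by
  fin_cases i <;> simp [polar, hr]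

/-- The components add up to `2 i r sin θ`, so the boundary condition concerns the angle alone. -/
theorem polar_zero_eq_neg_iff {r : ℝ → ℝ} (θ : ℝ → ℝ) {x : ℝ} (hr : r x ≠ 0) :
    polar r θ x 0 = -polar r θ x 1 ↔ Real.sin (θ x) = 0 := by
  have h : polar r θ x 0 + polar r θ x 1 = 2 * r x * Complex.I * Real.sin (θ x) := by
    simp only [polar, Matrix.cons_val_zero, Matrix.cons_val_one]
    rw [Complex.ofReal_sin, Complex.sin, show (θ x : ℂ) * Complex.I = Complex.I * θ x by ring,
      show -(θ x : ℂ) * Complex.I = -(Complex.I * θ x) by ring]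
    linear_combination (r x * (Complex.exp (Complex.I * θ x) -
      Complex.exp (-(Complex.I * θ x)))) * Complex.I_sq
  rw [eq_neg_iff_add_eq_zero, h]
  simp [hr, -Complex.ofReal_sin]

/-- Prüfer angles with end value in `π ℤ` give eigenfunctions. -/
theorem IsPruefer.isSystemEigenfunction (h : IsPruefer L d s θ) (hL : 0 < L) (hd : Continuous d)
    {n : ℤ} (hn : θ L = Real.pi * n) {α : ℂ} (hα : α ≠ 0) :
    IsSystemEigenfunction L d σ (Complex.I * s) (fun x => α • polar (amplitude d σ θ) θ x) := by
  have hr : ∀ x, amplitude d σ θ x ≠ 0 := fun x => (amplitude_pos d θ σ x).ne'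
  have hrhs : ∀ x, systemRhs d σ (Complex.I * s) x (α • polar (amplitude d σ θ) θ x) =
      α • systemRhs d σ (Complex.I * s) x (polar (amplitude d σ θ) θ x) := by
    intro x
    ext i
    fin_cases i <;> simp [systemRhs] <;> ring
  have hD : ∀ x ∈ Icc 0 L, HasDerivAt (fun x => α • polar (amplitude d σ θ) θ x)
      (systemRhs d σ (Complex.I * s) x (α • polar (amplitude d σ θ) θ x)) x := fun x hx => by
    rw [hrhs]
    exact (h.hasDerivAt_polar hd hx).const_smul α
  have hcont : Continuous fun x => α • polar (amplitude d σ θ) θ x :=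
    (continuous_polar (continuous_amplitude hd h.continuous σ) h.continuous).const_smul α
  have hcR : Continuous fun x =>
      systemRhs d σ (Complex.I * s) x (α • polar (amplitude d σ θ) θ x) :=
    continuousOn_univ.1 (continuousOn_systemRhs hd _ hcont.continuousOn)
  have hae : ∀ᵐ x ∂(volume.restrict (Ioo (0 : ℝ) L)),
      deriv (fun x => α • polar (amplitude d σ θ) θ x) x =
        systemRhs d σ (Complex.I * s) x (α • polar (amplitude d σ θ) θ x) := by
    filter_upwards [ae_restrict_mem measurableSet_Ioo] with x hx
    exact (hD x (Ioo_subset_Icc_self hx)).deriv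
  have hbc : ∀ x, Real.sin (θ x) = 0 → (α • polar (amplitude d σ θ) θ x) 0 =
      -(α • polar (amplitude d σ θ) θ x) 1 := by
    intro x hx
    rw [PiLp.smul_apply, PiLp.smul_apply, (polar_zero_eq_neg_iff θ (hr x)).2 hx, smul_neg]
  refine ⟨⟨⟨?_, ?_⟩, hbc 0 (by simp [h.zero]), hbc L ?_⟩, ⟨0, left_mem_Icc.2 hL.le, ?_⟩, hae⟩
  · obtain ⟨C, hC⟩ := (isCompact_Icc (a := (0 : ℝ)) (b := L)).exists_bound_of_continuousOn
      hcR.continuousOn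
    refine LipschitzOnWith.absolutelyContinuousOnInterval (K := C.toNNReal) ?_
    rw [uIcc_of_le hL.le]
    refine (convex_Icc 0 L).lipschitzOnWith_of_nnnorm_hasDerivWithin_le
      (fun x hx => (hD x hx).hasDerivWithinAt) fun x hx => ?_
    exact NNReal.coe_le_coe.1 ((hC x hx).trans (Real.le_coe_toNNReal C))
  · exact (memLp_of_continuous L hcR).ae_eq (hae.mono fun x hx => hx.symm)
  · rw [hn, mul_comm]
    exact Real.sin_int_mul_pi n
  · exact smul_ne_zero hα fun h0 => polar_ne_zero θ (hr 0) 0 (by simp [h0])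

theorem IsSystemEigenfunction.exists_eq {ζ : ℂ} {w : ℝ → C2} (hL : 0 < L) (hd : Continuous d)
    (h : IsSystemEigenfunction L d σ ζ w) :
    ∃ v : ℝ → C2, (∀ x ∈ Icc 0 L, v x = w x) ∧
      ∀ x ∈ Icc 0 L, HasDerivAt v (systemRhs d σ ζ x (v x)) x := by
  obtain ⟨v, hv, hv'⟩ := exists_hasDerivAt_of_absolutelyContinuous hL.le h.1.1.1
    (g := fun x => systemRhs d σ ζ x (w x))
    (continuousOn_systemRhs hd ζ (uIcc_of_le hL.le ▸ h.1.1.1.continuousOn)) h.2.2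
  refine ⟨v, hv, fun x hx => ?_⟩
  rw [hv x hx]
  exact hv' x hx

/-- The eigenvalues are purely imaginary, since the system is skew-adjoint up to a weight. -/
theorem IsSystemEigenfunction.re_eq_zero {ζ : ℂ} {w : ℝ → C2} (hL : 0 < L) (hd : Continuous d)
    (h : IsSystemEigenfunction L d σ ζ w) : ζ.re = 0 := by
  obtain ⟨v, hv, hv'⟩ := h.exists_eq hL hd
  by_contra hre
  -- With this weight the `σ` terms drop out, the coupling terms cancel, and the derivative of `p
  -- (|v₁|² - |v₂|²)` is `2 Re ζ · p ‖v‖²`. The boundary conditions annihilate the differentiated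
  -- quantity at both ends.
  let p : ℝ → ℝ := fun x => Real.exp (-(2 * σ) * ∫ t in (0 : ℝ)..x, d t)
  have hp : ∀ x, HasDerivAt p (p x * (-(2 * σ) * d x)) x := fun x =>
    ((intervalIntegral.integral_hasDerivAt_right (hd.intervalIntegrable 0 x)
      (hd.stronglyMeasurableAtFilter _ _) hd.continuousAt).const_mul _).exp
  have hpc : Continuous p := continuous_iff_continuousAt.2 fun x => (hp x).continuousAt
  have hvc : ContinuousOn v (Icc 0 L) := fun x hx => (hv' x hx).continuousAt.continuousWithinAt
  have hM : ContinuousOn (fun x => p x * ‖v x‖ ^ 2) (Icc 0 L) :=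
    hpc.continuousOn.mul (hvc.norm.pow 2)
  have hD : ∀ x ∈ uIcc 0 L, HasDerivAt
      (fun x => (p x : ℂ) * (v x 0 * conj (v x 0) - v x 1 * conj (v x 1)))
      ((2 * ζ.re * (p x * ‖v x‖ ^ 2) : ℝ) : ℂ) x := by
    intro x hx
    rw [uIcc_of_le hL.le] at hx
    have h0 := hasDerivAt_apply_C2 (hv' x hx) 0
    have h1 := hasDerivAt_apply_C2 (hv' x hx) 1
    convert! (hp x).ofReal_comp.mul ((h0.mul h0.star).sub (h1.mul h1.star)) using 1
    rw [EuclideanSpace.norm_sq_eq, Fin.sum_univ_two]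
    have h2 : (2 * ζ.re : ℂ) = ζ + conj ζ := by
      rw [Complex.add_conj]
      push_cast
      rfl
    push_cast
    rw [h2, ← Complex.mul_conj', ← Complex.mul_conj']
    simp only [systemRhs, Matrix.cons_val_zero, Matrix.cons_val_one, ← starRingEnd_apply, map_sub,
      Pi.sub_apply, Pi.mul_apply,
      map_add, map_mul, map_neg, map_div₀, Complex.conj_ofReal, map_ofNat]
    ring
  have hint := intervalIntegral.integral_eq_sub_of_hasDerivAt hD
    ((Complex.continuous_ofReal.comp_continuousOn (hM.const_mul (2 * ζ.re))).intervalIntegrable_of_Icc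
      hL.le)
  have hbc : ∀ x ∈ Icc 0 L, w x 0 = -w x 1 →
      (p x : ℂ) * (v x 0 * conj (v x 0) - v x 1 * conj (v x 1)) = 0 := by
    intro x hx hw
    rw [hv x hx, hw, map_neg]
    ring
  rw [hbc L (right_mem_Icc.2 hL.le) h.1.2.2, hbc 0 (left_mem_Icc.2 hL.le) h.1.2.1, sub_zero,
    intervalIntegral.integral_ofReal, Complex.ofReal_eq_zero, intervalIntegral.integral_const_mul,
    mul_eq_zero] at hint
  obtain ⟨c, hc, hwc⟩ := h.2.1
  have hpos := intervalIntegral.integral_pos hL hM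
    (fun x _ => mul_nonneg (Real.exp_pos _).le (sq_nonneg _))
    ⟨c, hc, mul_pos (Real.exp_pos _) (by rw [hv c hc]; positivity)⟩
  rcases hint with h0 | h0
  · exact hre (by linarith)
  · exact hpos.ne' h0

/-- Eigenfunctions are multiples of the eigenfunction in polar form. -/
theorem IsSystemEigenfunction.exists_eq_smul_polar {w : ℝ → C2} (hL : 0 < L) (hd : Continuous d)
    (h : IsSystemEigenfunction L d σ (Complex.I * s) w) (hθ : IsPruefer L d s θ) :
    (∃ n : ℤ, θ L = Real.pi * n) ∧
      ∃ α : ℂ, α ≠ 0 ∧ ∀ x ∈ Icc 0 L, w x = α • polar (amplitude d σ θ) θ x := by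
  obtain ⟨v, hv, hv'⟩ := h.exists_eq hL hd
  have hr : ∀ τ x, amplitude d τ θ x ≠ 0 := fun τ x => (amplitude_pos d θ τ x).ne'
  have h0mem := left_mem_Icc.2 hL.le
  have hLmem := right_mem_Icc.2 hL.le
  have hconst : ∀ {f : ℝ → ℂ}, (∀ x ∈ Icc 0 L, HasDerivAt f 0 x) → ∀ x ∈ Icc 0 L, f x = f 0 := by
    intro f hf x hx
    exact (convex_Icc 0 L).is_const_of_fderivWithin_eq_zero (𝕜 := ℝ)
      (fun y hy => (hf y hy).differentiableAt.differentiableWithinAt)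
      (fun y hy => by
        rw [((hf y hy).hasFDerivAt.hasFDerivWithinAt).fderivWithin
          (uniqueDiffOn_Icc hL y hy)]
        simp) hx h0mem
  have hp0 : ∀ τ, polar (amplitude d τ θ) θ 0 0 = 1 ∧ polar (amplitude d τ θ) θ 0 1 = -1 := by
    intro τ
    simp [polar, amplitude_zero, hθ.zero]
  have hv0 : v 0 0 = -v 0 1 := by
    rw [hv 0 h0mem]
    exact h.1.2.1
  -- The Wronskian of a solution for `σ` with one for `-σ` is constant, since the traces of the two
  -- systems cancel; it vanishes at `0` by the boundary condition.
  have hcross : ∀ x ∈ Icc 0 L, v x 0 * polar (amplitude d (-σ) θ) θ x 1 =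
      v x 1 * polar (amplitude d (-σ) θ) θ x 0 := by
    intro x hx
    have h1 := hconst (f := fun x => v x 0 * polar (amplitude d (-σ) θ) θ x 1 -
      v x 1 * polar (amplitude d (-σ) θ) θ x 0) (fun y hy => ?_) x hx
    · rw [(hp0 _).1, (hp0 _).2, hv0] at h1
      linear_combination h1
    · have hP := hθ.hasDerivAt_polar (σ := -σ) hd hy
      convert! ((hasDerivAt_apply_C2 (hv' y hy) 0).mul (hasDerivAt_apply_C2 hP 1)).sub
        ((hasDerivAt_apply_C2 (hv' y hy) 1).mul (hasDerivAt_apply_C2 hP 0)) using 1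
      simp only [systemRhs, Matrix.cons_val_zero, Matrix.cons_val_one]
      push_cast
      ring
  -- The polar functions for `σ` and `-σ` have the same angle, so they are parallel at every point.
  have hcross' : ∀ x ∈ Icc 0 L, v x 0 * polar (amplitude d σ θ) θ x 1 =
      v x 1 * polar (amplitude d σ θ) θ x 0 := by
    intro x hx
    have h1 := hcross x hx
    simp only [polar, Matrix.cons_val_zero, Matrix.cons_val_one] at h1 ⊢
    have h2 : (amplitude d (-σ) θ x : ℂ) ≠ 0 := by exact_mod_cast hr _ x
    refine mul_left_cancel₀ h2 ?_
    linear_combination (amplitude d σ θ x : ℂ) * h1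
  -- Parallelism makes the numerator of the derivative of the quotient vanish.
  have hquot : ∀ x ∈ Icc 0 L, v x 0 = v 0 0 * polar (amplitude d σ θ) θ x 0 := by
    intro x hx
    have h1 := hconst (f := fun x => v x 0 / polar (amplitude d σ θ) θ x 0) (fun y hy => ?_) x hx
    · rw [(hp0 σ).1, div_one, div_eq_iff (polar_ne_zero θ (hr σ x) 0)] at h1
      exact h1
    · have hP := hθ.hasDerivAt_polar (σ := σ) hd hy
      convert! (hasDerivAt_apply_C2 (hv' y hy) 0).div (hasDerivAt_apply_C2 hP 0)
        (polar_ne_zero θ (hr σ y) 0) using 1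
      simp only [systemRhs, Matrix.cons_val_zero]
      rw [eq_comm, div_eq_zero_iff]
      left
      linear_combination (d y / 3 : ℂ) * hcross' y hy
  have hv1 : ∀ x ∈ Icc 0 L, v x = v 0 0 • polar (amplitude d σ θ) θ x := by
    intro x hx
    ext i
    fin_cases i
    · simpa using hquot x hx
    · have h1 := hcross' x hx
      rw [hquot x hx] at h1
      have h2 := polar_ne_zero θ (hr σ x) 0
      refine mul_right_cancel₀ h2 ?_
      simp only [Fin.mk_one, PiLp.smul_apply, smul_eq_mul]
      linear_combination -h1
  have hα : v 0 0 ≠ 0 := by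
    intro h0
    obtain ⟨c, hc, hwc⟩ := h.2.1
    exact hwc (by rw [← hv c hc, hv1 c hc, h0, zero_smul])
  refine ⟨?_, v 0 0, hα, fun x hx => by rw [← hv x hx, hv1 x hx]⟩
  have h1 := h.1.2.2
  rw [← hv L hLmem, hv1 L hLmem, PiLp.smul_apply, PiLp.smul_apply, smul_eq_mul, smul_eq_mul,
    ← mul_neg] at h1
  have h2 := (polar_zero_eq_neg_iff θ (hr σ L)).1 (mul_left_cancel₀ hα h1)
  obtain ⟨n, hn⟩ := Real.sin_eq_zero_iff.1 h2
  exact ⟨n, by rw [← hn, mul_comm]⟩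

end System

/-! ### Riesz bases from orthogonal families; multiplication operators -/

/-- The diagonal operator on `ℓ²` with bounded diagonal `c`. -/
def diagonalCLM {ι : Type*} (c : ι → ℂ) {C : ℝ} (hc : ∀ i, ‖c i‖ ≤ C) :
    lp (fun _ : ι => ℂ) 2 →L[ℂ] lp (fun _ : ι => ℂ) 2 :=
  have hle : ∀ (f : lp (fun _ : ι => ℂ) 2) i, ‖c i * f i‖ ≤ ‖((C : ℂ) • f) i‖ := fun f i => by
    rw [lp.coeFn_smul, Pi.smul_apply, smul_eq_mul, norm_mul, norm_mul, Complex.norm_real]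
    exact mul_le_mul_of_nonneg_right ((hc i).trans (le_abs_self C)) (norm_nonneg _)
  LinearMap.mkContinuous
    { toFun := fun f => ⟨fun i => c i * f i, (lp.memℓp ((C : ℂ) • f)).mono' (hle f)⟩
      map_add' := fun f g => by
        ext i
        exact mul_add _ _ _
      map_smul' := fun a f => by
        ext i
        exact mul_left_comm _ _ _ }
    ‖(C : ℂ)‖ fun f => (lp.norm_mono two_ne_zero (hle f)).trans (norm_smul_le _ _)

theorem diagonalCLM_apply {ι : Type*} (c : ι → ℂ) {C : ℝ} (hc : ∀ i, ‖c i‖ ≤ C)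
    (f : lp (fun _ : ι => ℂ) 2) (i : ι) : diagonalCLM c hc f i = c i * f i := rfl

theorem HilbertBasis.exists_diagonal {ι H : Type*} [NormedAddCommGroup H] [InnerProductSpace ℂ H]
    (b : HilbertBasis ι ℂ H) {c : ι → ℂ} {C m : ℝ} (hm : 0 < m) (hcm : ∀ i, m ≤ ‖c i‖)
    (hC : ∀ i, ‖c i‖ ≤ C) : ∃ D : H ≃L[ℂ] H, ∀ i, D (b i) = c i • b i := by
  classical
  have hc0 : ∀ i, c i ≠ 0 := fun i => norm_pos_iff.1 (hm.trans_le (hcm i))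
  have hinv : ∀ i, ‖(c i)⁻¹‖ ≤ m⁻¹ := fun i => by
    rw [norm_inv]
    exact inv_anti₀ hm (hcm i)
  let E : lp (fun _ : ι => ℂ) 2 ≃L[ℂ] lp (fun _ : ι => ℂ) 2 :=
    ContinuousLinearEquiv.equivOfInverse (diagonalCLM c hC) (diagonalCLM (fun i => (c i)⁻¹) hinv)
      (fun f => by
        ext i
        rw [diagonalCLM_apply, diagonalCLM_apply, inv_mul_cancel_left₀ (hc0 i)])
      (fun f => by
        ext i
        rw [diagonalCLM_apply, diagonalCLM_apply, mul_inv_cancel_left₀ (hc0 i)])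
  let e := b.repr.toContinuousLinearEquiv
  refine ⟨(e.trans E).trans e.symm, fun i => ?_⟩
  have h1 : E (b.repr (b i)) = c i • b.repr (b i) := by
    ext j
    change c j * b.repr (b i) j = c i * b.repr (b i) j
    rw [b.repr_self, lp.single_apply, Pi.single_apply]
    by_cases hj : j = i
    · rw [hj]
    · simp [hj]
  change b.repr.symm (E (b.repr (b i))) = _
  rw [h1, map_smul, LinearIsometryEquiv.symm_apply_apply]

/-- A complete orthogonal family of vectors of norm bounded above and below becomes, after bounded
rescaling and application of an isomorphism, a Riesz basis. -/
theorem isRieszBasis_of_orthogonal {ι H : Type*} [NormedAddCommGroup H] [InnerProductSpace ℂ H]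
    [CompleteSpace H] {v : ι → H} (hv : Pairwise fun i j => inner ℂ (v i) (v j) = 0)
    (hcomplete : ∀ f, (∀ i, inner ℂ (v i) f = 0) → f = 0) {a : ι → ℂ} {m M : ℝ} (hm : 0 < m)
    (hlow : ∀ i, m ≤ ‖a i‖ * ‖v i‖) (hup : ∀ i, ‖a i‖ * ‖v i‖ ≤ M) (A : H ≃L[ℂ] H) :
    IsRieszBasis fun i => A (a i • v i) := by
  have hv0 : ∀ i, ‖v i‖ ≠ 0 := fun i h0 => by
    have := hlow i
    rw [h0, mul_zero] at this
    linarith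
  let u : ι → H := fun i => (‖v i‖ : ℂ)⁻¹ • v i
  have hu : Orthonormal ℂ u := by
    refine ⟨fun i => ?_, fun i j hij => ?_⟩
    · rw [norm_smul, norm_inv, Complex.norm_real, norm_norm, inv_mul_cancel₀ (hv0 i)]
    · simp only [u, inner_smul_left, inner_smul_right, hv hij, mul_zero]
  have hbot : (Submodule.span ℂ (Set.range u))ᗮ = ⊥ := by
    rw [Submodule.eq_bot_iff]
    intro f hf
    refine hcomplete f fun i => ?_
    have h1 := (Submodule.mem_orthogonal _ f).1 hf (u i) (Submodule.subset_span ⟨i, rfl⟩)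
    simp only [u, inner_smul_left, mul_eq_zero] at h1
    refine h1.resolve_left ?_
    simpa using hv0 i
  let b := HilbertBasis.mkOfOrthogonalEqBot hu hbot
  have hb : ∀ i, b i = u i := fun i => congrFun (HilbertBasis.coe_mkOfOrthogonalEqBot hu hbot) i
  have hn : ∀ i, ‖a i * (‖v i‖ : ℂ)‖ = ‖a i‖ * ‖v i‖ := fun i => by
    rw [norm_mul, Complex.norm_real, norm_norm]
  obtain ⟨D, hD⟩ := HilbertBasis.exists_diagonal b (c := fun i => a i * (‖v i‖ : ℂ)) hm
    (fun i => (hlow i).trans_eq (hn i).symm) (fun i => (hn i).trans_le (hup i))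
  refine ⟨b, D.trans A, fun i => ?_⟩
  rw [ContinuousLinearEquiv.trans_apply, hD, hb, smul_smul, mul_assoc, mul_inv_cancel₀, mul_one]
  exact_mod_cast hv0 i

/-- Multiplication by a continuous function on `L²((0, L); ℂ²)`. -/
def mulCLM (L : ℝ) {m : ℝ → ℂ} (hm : MemLp m ∞ (volume.restrict (Ioo (0 : ℝ) L))) :
    L2Space L →L[ℂ] L2Space L :=
  LinearMap.mkContinuous
    { toFun := fun f => (hm.toLp m • f : L2Space L)
      map_add' := fun f g => Lp.add_smul (p := ∞) (q := 2) (r := 2) (hm.toLp m) f g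
      map_smul' := fun c f =>
        (Lp.smul_comm (p := ∞) (q := 2) (r := 2) c (hm.toLp m) f).symm }
    ‖hm.toLp m‖ fun f => Lp.norm_smul_le (p := ∞) (q := 2) (r := 2) (hm.toLp m) f

theorem coeFn_mulCLM (L : ℝ) {m : ℝ → ℂ} (hm : MemLp m ∞ (volume.restrict (Ioo (0 : ℝ) L)))
    (f : L2Space L) : mulCLM L hm f =ᵐ[volume.restrict (Ioo (0 : ℝ) L)] fun x => m x • f x := by
  filter_upwards [Lp.coeFn_lpSMul (p := ∞) (q := 2) (r := 2) (hm.toLp m) f, hm.coeFn_toLp]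
    with x h1 h2
  change (hm.toLp m • f : L2Space L) x = _
  rw [h1, Pi.smul_apply', h2]

theorem exists_mul_equiv (L : ℝ) {m : ℝ → ℂ} (hm : Continuous m) (hm0 : ∀ x, m x ≠ 0) :
    ∃ A : L2Space L ≃L[ℂ] L2Space L, ∀ (f : ℝ → C2)
      (hf : MemLp f 2 (volume.restrict (Ioo (0 : ℝ) L)))
      (hf' : MemLp (fun x => m x • f x) 2 (volume.restrict (Ioo (0 : ℝ) L))),
      A (hf.toLp f) = hf'.toLp _ := by
  have hbdd : ∀ {p : ℝ → ℂ}, Continuous p → MemLp p ∞ (volume.restrict (Ioo (0 : ℝ) L)) := by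
    intro p hp
    obtain ⟨C, hC⟩ := (isCompact_Icc (a := (0 : ℝ)) (b := L)).exists_bound_of_continuousOn
      hp.continuousOn
    refine MemLp.of_bound hp.aestronglyMeasurable C ?_
    filter_upwards [ae_restrict_mem measurableSet_Ioo] with x hx
    exact hC x (Ioo_subset_Icc_self hx)
  have h1 := hbdd hm
  have h2 : MemLp (fun x => (m x)⁻¹) ∞ (volume.restrict (Ioo (0 : ℝ) L)) := hbdd (hm.inv₀ hm0)
  refine ⟨ContinuousLinearEquiv.equivOfInverse (mulCLM L h1) (mulCLM L h2) (fun f => ?_)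
    (fun f => ?_), fun f hf hf' => ?_⟩
  · refine Lp.ext ?_
    filter_upwards [coeFn_mulCLM L h1 f, coeFn_mulCLM L h2 (mulCLM L h1 f)] with x hx1 hx2
    rw [hx2, hx1, smul_smul, inv_mul_cancel₀ (hm0 x), one_smul]
  · refine Lp.ext ?_
    filter_upwards [coeFn_mulCLM L h2 f, coeFn_mulCLM L h1 (mulCLM L h2 f)] with x hx1 hx2
    rw [hx2, hx1, smul_smul, mul_inv_cancel₀ (hm0 x), one_smul]
  · refine Lp.ext ?_
    filter_upwards [coeFn_mulCLM L h1 (hf.toLp f), hf.coeFn_toLp, hf'.coeFn_toLp] with x hx1 hx2 hx3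
    rw [hx3, ← hx2]
    exact hx1

/-! ### The explicit coefficient -/

/-- The coefficient `δ`, extended from `[0, L]` to the line by constants. -/
def deltaExt (L γ x : ℝ) : ℝ := delta L γ (max 0 (min x L))

theorem deltaExt_eq {L γ x : ℝ} (hx : x ∈ Icc 0 L) : deltaExt L γ x = delta L γ x := by
  rw [deltaExt, min_eq_left hx.2, max_eq_right hx.1]

section Delta

variable {L γ : ℝ}

/-- Once `γ` is cancelled, `δ` has the form `-(3/2) B / (A - B x)`, from which `δ' = -(2/3) δ²` can
be read off. -/
theorem delta_eq (hγ : γ ≠ 0) (hL : L ≠ 0) (x : ℝ) :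
    delta L γ x = -(3 / 2) *
      ((Real.sqrt (1 + γ * L / 2) - Real.sqrt (1 - γ * L / 2)) / L /
        (Real.sqrt (1 + γ * L / 2) -
          (Real.sqrt (1 + γ * L / 2) - Real.sqrt (1 - γ * L / 2)) / L * x)) := by
  have h : γ * Lgam L γ * x / (2 * L) =
      (Real.sqrt (1 + γ * L / 2) - Real.sqrt (1 - γ * L / 2)) / L * x := by
    rw [Lgam]
    field_simp
  rw [delta, h, Lgam, ← mul_div_assoc, ← mul_div_assoc]
  congr 1
  field_simp
  ring

theorem sqrt_bounds (hL : 0 < L) (hγ : 0 < γ) (h : γ * L ≤ 1 / 4) :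
    9 / 10 ≤ Real.sqrt (1 - γ * L / 2) ∧
      Real.sqrt (1 - γ * L / 2) ≤ Real.sqrt (1 + γ * L / 2) ∧
      Real.sqrt (1 + γ * L / 2) ≤ 11 / 10 ∧
      (Real.sqrt (1 + γ * L / 2) - Real.sqrt (1 - γ * L / 2)) *
        (Real.sqrt (1 + γ * L / 2) + Real.sqrt (1 - γ * L / 2)) = γ * L := by
  have h0 : 0 < γ * L := by positivity
  refine ⟨Real.le_sqrt_of_sq_le (by linarith), Real.sqrt_le_sqrt (by linarith), ?_, ?_⟩
  · rw [Real.sqrt_le_left (by norm_num)]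
    linarith
  · have h1 := Real.mul_self_sqrt (show 0 ≤ 1 + γ * L / 2 by linarith)
    have h2 := Real.mul_self_sqrt (show 0 ≤ 1 - γ * L / 2 by linarith)
    linear_combination h1 - h2

theorem delta_denominator_mem (hL : 0 < L) (hγ : 0 < γ) (h : γ * L ≤ 1 / 4) {x : ℝ}
    (hx : x ∈ Icc 0 L) :
    Real.sqrt (1 + γ * L / 2) - (Real.sqrt (1 + γ * L / 2) - Real.sqrt (1 - γ * L / 2)) / L * x ∈
      Icc (9 / 10 : ℝ) (11 / 10) := by
  obtain ⟨h1, h2, h3, -⟩ := sqrt_bounds hL hγ h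
  have h4 : (Real.sqrt (1 + γ * L / 2) - Real.sqrt (1 - γ * L / 2)) / L * x ≤
      Real.sqrt (1 + γ * L / 2) - Real.sqrt (1 - γ * L / 2) := by
    rw [div_mul_eq_mul_div, div_le_iff₀ hL]
    exact mul_le_mul_of_nonneg_left hx.2 (by linarith)
  have h5 : 0 ≤ (Real.sqrt (1 + γ * L / 2) - Real.sqrt (1 - γ * L / 2)) / L * x :=
    mul_nonneg (div_nonneg (by linarith) hL.le) hx.1
  constructor <;> linarith

theorem delta_mem (hL : 0 < L) (hγ : 0 < γ) (h : γ * L ≤ 1 / 4) {x : ℝ} (hx : x ∈ Icc 0 L) :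
    delta L γ x ∈ Icc (-(3 / 2 * γ)) (-(γ / 2)) := by
  obtain ⟨h1, h2, h3, h4⟩ := sqrt_bounds hL hγ h
  have h5 := delta_denominator_mem hL hγ h hx
  rw [delta_eq hγ.ne' hL.ne']
  generalize Real.sqrt (1 + γ * L / 2) -
    (Real.sqrt (1 + γ * L / 2) - Real.sqrt (1 - γ * L / 2)) / L * x = D at *
  generalize Real.sqrt (1 + γ * L / 2) = A at *
  generalize Real.sqrt (1 - γ * L / 2) = A' at *
  -- From `A² - A'² = γ L`; this exhibits the factor `γ` in the coefficient.
  have h6 : (A - A') / L = γ / (A + A') := by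
    rw [div_eq_div_iff hL.ne' (by linarith), h4]
  have h7 : 1 ≤ (A + A') * D := by nlinarith [h5.1]
  have h8 : (A + A') * D ≤ 3 := by nlinarith [h5.2, h5.1]
  rw [h6, div_div]
  have h9 : γ / ((A + A') * D) ≤ γ := div_le_self hγ.le h7
  have h10 : γ / 3 ≤ γ / ((A + A') * D) := by gcongr
  constructor <;> linarith

theorem hasDerivAt_delta (hL : 0 < L) (hγ : 0 < γ) (h : γ * L ≤ 1 / 4) {x : ℝ}
    (hx : x ∈ Icc 0 L) : HasDerivAt (delta L γ) (-(2 / 3) * delta L γ x ^ 2) x := by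
  have h5 := delta_denominator_mem hL hγ h hx
  rw [delta_eq hγ.ne' hL.ne', show delta L γ = _ from funext (delta_eq hγ.ne' hL.ne')]
  generalize (Real.sqrt (1 + γ * L / 2) - Real.sqrt (1 - γ * L / 2)) / L = B at *
  generalize Real.sqrt (1 + γ * L / 2) = A at *
  have h6 : A - B * x ≠ 0 := by linarith [h5.1]
  have h7 : HasDerivAt (fun y => A - B * y) (-B) x := by
    simpa using ((hasDerivAt_id x).const_mul B).const_sub A
  convert! ((hasDerivAt_const x B).div h7 h6).const_mul (-(3 / 2)) using 1
  field_simp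
  ring

theorem max_min_mem_Icc (hL : 0 ≤ L) (x : ℝ) : max 0 (min x L) ∈ Icc 0 L :=
  ⟨le_max_left _ _, max_le hL (min_le_right _ _)⟩

theorem isCoefficient_deltaExt (hL : 0 < L) (hγ : 0 < γ) (h : γ * L ≤ 1 / 4) :
    IsCoefficient L γ (deltaExt L γ) where
  continuous := by
    have h1 : ContinuousOn (delta L γ) (Icc 0 L) := fun x hx =>
      (hasDerivAt_delta hL hγ h hx).continuousAt.continuousWithinAt
    exact h1.comp_continuous (by fun_prop) (max_min_mem_Icc hL.le)
  ge x := (delta_mem hL hγ h (max_min_mem_Icc hL.le x)).1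
  le x := (delta_mem hL hγ h (max_min_mem_Icc hL.le x)).2
  hasDerivAt x hx := by
    rw [deltaExt_eq (Ioo_subset_Icc_self hx)]
    refine (hasDerivAt_delta hL hγ h (Ioo_subset_Icc_self hx)).congr_of_eventuallyEq ?_
    filter_upwards [Ioo_mem_nhds hx.1 hx.2] with y hy
    exact deltaExt_eq (Ioo_subset_Icc_self hy)

/-- Joint continuity of `δ` in `(γ, x)` and compactness of `[0, L]` give continuity in `γ` uniformly
in `x`, as the comparison of spectral parameters needs. -/
theorem eventually_abs_deltaExt_sub_lt {γ₀ η : ℝ} (hL : 0 < L) (hγ₀ : γ₀ * L ≤ 1 / 4)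
    (hη : 0 < η) (hγ : γ ∈ Ioo 0 γ₀) :
    ∀ᶠ γ' in 𝓝[Ioo 0 γ₀] γ, ∀ x ∈ Icc 0 L, |deltaExt L γ' x - deltaExt L γ x| < η := by
  have hcont : ContinuousOn (Function.uncurry (delta L)) (Ioo 0 γ₀ ×ˢ Icc 0 L) := by
    have h1 : ContinuousOn (fun p : ℝ × ℝ => -(3 / 2) *
      ((Real.sqrt (1 + p.1 * L / 2) - Real.sqrt (1 - p.1 * L / 2)) / L /
        (Real.sqrt (1 + p.1 * L / 2) -
          (Real.sqrt (1 + p.1 * L / 2) - Real.sqrt (1 - p.1 * L / 2)) / L * p.2)))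
        (Ioo 0 γ₀ ×ˢ Icc 0 L) := by
      refine ContinuousOn.mul continuousOn_const (ContinuousOn.div ?_ ?_ ?_)
      · exact Continuous.continuousOn (by fun_prop)
      · exact Continuous.continuousOn (by fun_prop)
      · intro p hp
        have hle : p.1 * L ≤ 1 / 4 :=
          (mul_le_mul_of_nonneg_right hp.1.2.le hL.le).trans hγ₀
        linarith [(delta_denominator_mem hL hp.1.1 hle hp.2).1]
    exact h1.congr fun p hp => delta_eq hp.1.1.ne' hL.ne' p.2
  obtain ⟨v, hv, hv'⟩ := isCompact_Icc.mem_uniformity_of_prod hcont hγ (Metric.dist_mem_uniformity hη)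
  filter_upwards [hv] with γ' hγ' x hx
  rw [deltaExt_eq hx, deltaExt_eq hx]
  exact hv' γ' hγ' x hx

end Delta

/-! ### Normalization, the moment identity and orthogonality -/

section Normalization

variable {L γ s s' σ : ℝ} {d θ θ' : ℝ → ℝ}

theorem pairing_congr (hL : 0 ≤ L) {f f' g g' : ℝ → C2} (hf : ∀ x ∈ Icc 0 L, f x = f' x)
    (hg : ∀ x ∈ Icc 0 L, g x = g' x) : pairing L f g = pairing L f' g' := by
  rw [pairing, pairing]
  congr 1
  refine intervalIntegral.integral_congr fun x hx => ?_
  rw [uIcc_of_le hL] at hx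
  simp only [hf x hx, hg x hx]

theorem abs_mean_sub_one_le {c : ℝ} (hL : 0 < L) {f : ℝ → ℝ} (hf : Continuous f)
    (h : ∀ x ∈ Icc 0 L, |f x - 1| ≤ c) : |1 / L * (∫ x in (0 : ℝ)..L, f x) - 1| ≤ c := by
  have h1 := intervalIntegral.norm_integral_le_of_norm_le_const (a := 0) (b := L)
    (f := fun x => f x - 1) (C := c) fun x hx => by
      rw [uIoc_of_le hL.le] at hx
      exact h x (Ioc_subset_Icc_self hx)
  rw [intervalIntegral.integral_sub (hf.intervalIntegrable _ _) (by simp)] at h1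
  simp only [intervalIntegral.integral_const, sub_zero, smul_eq_mul, mul_one, Real.norm_eq_abs,
    abs_of_pos hL] at h1
  have h2 : 1 / L * (∫ x in (0 : ℝ)..L, f x) - 1 = ((∫ x in (0 : ℝ)..L, f x) - L) / L := by
    field_simp
  rw [h2, abs_div, abs_of_pos hL]
  exact (div_le_iff₀ hL).2 h1

theorem continuous_phase (L : ℝ) (n : ℤ) : Continuous (phase L n) := by
  unfold phase
  fun_prop

/-- The normalization factor of an eigenfunction. -/
def overlap (L : ℝ) (r θ : ℝ → ℝ) (n : ℤ) : ℝ :=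
  1 / L * ∫ x in (0 : ℝ)..L, r x * Real.cos (θ x - phase L n x)

theorem IsCoefficient.abs_overlap_sub_one_le (hd : IsCoefficient L γ d) (hL : 0 < L)
    (hγ : γ * L ≤ 1 / 1000) (hσ : |σ| ≤ 1) (h : IsPruefer L d s θ) {n : ℤ}
    (hn : θ L = Real.pi * n) : |overlap L (amplitude d σ θ) θ n - 1| ≤ 1 / 100 := by
  have h0 : 0 ≤ γ * L := mul_nonneg hd.gamma_nonneg hL.le
  have hr := continuous_amplitude hd.continuous h.continuous σ
  have hθ := h.continuous
  have hph := continuous_phase L n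
  refine abs_mean_sub_one_le hL (by fun_prop) fun x hx => ?_
  have h1 := hd.abs_amplitude_sub_one_le (θ := θ) (by linarith) hσ hx
  have h2 := hd.abs_angle_sub_phase_le hL h hn hx
  have h3 := Real.one_sub_sq_div_two_le_cos (x := θ x - phase L n x)
  have h4 := Real.cos_le_one (θ x - phase L n x)
  have h5 : (θ x - phase L n x) ^ 2 ≤ (1 / 1000) ^ 2 := by
    rw [← sq_abs]
    exact pow_le_pow_left₀ (abs_nonneg _) (by linarith) 2
  generalize Real.cos (θ x - phase L n x) = c at *
  generalize amplitude d σ θ x = r at *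
  rw [abs_le] at h1 ⊢
  constructor <;> nlinarith

/-- The normalization determines the free scalar, which is therefore real and close to `1`. -/
theorem IsSystemEigenfunction.eq_smul_polar_of_pairing {w : ℝ → C2} (hL : 0 < L)
    (hd : IsCoefficient L γ d) (hw : IsSystemEigenfunction L d σ (Complex.I * s) w)
    (h : IsPruefer L d s θ) {n : ℤ} (hpair : pairing L w (psi0 L n) = 1) :
    ∀ x ∈ Icc 0 L, w x =
      (((overlap L (amplitude d σ θ) θ n)⁻¹ : ℝ) : ℂ) • polar (amplitude d σ θ) θ x := by
  obtain ⟨-, α, -, hα⟩ := hw.exists_eq_smul_polar hL hd.continuous h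
  have h1 : pairing L w (psi0 L n) =
      pairing L (fun x => α • polar (amplitude d σ θ) θ x)
        (fun x => (1 : ℂ) • polar (fun _ => 1) (phase L n) x) :=
    pairing_congr hL.le hα fun x _ => by rw [psi0_eq_polar, one_smul]
  rw [pairing_smul_polar] at h1
  simp only [map_one, mul_one] at h1
  rw [hpair, ← overlap] at h1
  rw [Complex.ofReal_inv, ← eq_inv_of_mul_eq_one_left h1.symm]
  exact hα

theorem pairing_conj_symm (L : ℝ) (f g : ℝ → C2) : conj (pairing L f g) = pairing L g f := by
  simp only [pairing, intervalIntegral, map_mul, map_sub, ← integral_conj]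
  simp [mul_comm, map_ofNat (starRingEnd ℂ) 2]

/-- A primitive of `-s r sin θ` is `r cos θ - (4 / (3 s)) d r sin θ`: the terms quadratic in `d`
cancel exactly because `d' = -(2/3) d²`. The correction vanishes at both ends, where `sin θ = 0`. -/
theorem IsPruefer.mul_integral_amplitude_sin (hL : 0 < L) (hd : IsCoefficient L γ d)
    (h : IsPruefer L d s θ) (hs : s ≠ 0) {n : ℤ} (hn : θ L = Real.pi * n) :
    s * ∫ x in (0 : ℝ)..L, amplitude d 1 θ x * Real.sin (θ x) =
      1 - amplitude d 1 θ L * Real.cos (θ L) := by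
  have hc := hd.continuous
  have hθ := h.continuous
  have hr := continuous_amplitude hc hθ 1
  have h1 := intervalIntegral.integral_eq_sub_of_hasDerivAt_of_le hL.le
    (f := fun x => amplitude d 1 θ x * Real.cos (θ x) -
      4 / 3 / s * (d x * (amplitude d 1 θ x * Real.sin (θ x))))
    (f' := fun x => -s * (amplitude d 1 θ x * Real.sin (θ x)))
    (Continuous.continuousOn (by fun_prop)) (fun x hx => ?_)
    ((by fun_prop : Continuous _).intervalIntegrable _ _)
  · rw [intervalIntegral.integral_const_mul] at h1
    have h2 : Real.sin (θ L) = 0 := by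
      rw [hn, mul_comm]
      exact Real.sin_int_mul_pi n
    simp only [h2, h.zero, amplitude_zero, Real.sin_zero, Real.cos_zero, mul_zero, sub_zero,
      mul_one] at h1
    linarith
  · have hθ' := h.hasDerivAt x (Ioo_subset_Icc_self hx)
    have hr' := hasDerivAt_amplitude hc hθ 1 x
    have hd' := hd.hasDerivAt x hx
    convert! (hr'.mul hθ'.cos).sub ((hd'.mul (hr'.mul hθ'.sin)).const_mul (4 / 3 / s)) using 1
    simp only [Pi.mul_apply]
    rw [Real.cos_two_mul', Real.sin_two_mul]
    have h3 := Real.sin_sq_add_cos_sq (θ x)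
    generalize Real.sin (θ x) = S at *
    generalize Real.cos (θ x) = C at *
    generalize amplitude d 1 θ x = r at *
    field_simp
    linear_combination -(3 * s * r * d x * C + 4 * d x ^ 2 * r * S) * h3

/-- Since `1 + cos (2θ) / 3 ≥ 2 / 3` and `d ≤ -γ / 2`, the exponent is at most `-γ L / 3`; then
`e^{-t} ≤ 1 - t / 2` for small `t ≥ 0`. This strict loss of amplitude yields the lower bound on the
moments. -/
theorem IsCoefficient.amplitude_one_le (hd : IsCoefficient L γ d) (hL : 0 < L)
    (hγ : γ * L ≤ 1 / 4) (hθ : Continuous θ) : amplitude d 1 θ L ≤ 1 - γ * L / 6 := by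
  have h0 : 0 ≤ γ * L := mul_nonneg hd.gamma_nonneg hL.le
  have h1 : ∫ t in (0 : ℝ)..L, d t * (1 + Real.cos (2 * θ t) / 3) ≤ ∫ _ in (0 : ℝ)..L, -(γ / 3) := by
    refine intervalIntegral.integral_mono_on hL.le
      ((continuous_log_amplitude hd.continuous hθ 1).intervalIntegrable _ _) (by simp)
      fun t _ => ?_
    have h2 := hd.le t
    have h3 := Real.neg_one_le_cos (2 * θ t)
    have h4 := hd.gamma_nonneg
    nlinarith
  rw [intervalIntegral.integral_const, sub_zero, smul_eq_mul] at h1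
  have h2 : amplitude d 1 θ L ≤ Real.exp (-(γ * L / 3)) := Real.exp_le_exp.2 (by linarith)
  refine h2.trans ?_
  rw [Real.exp_neg, inv_le_comm₀ (Real.exp_pos _) (by linarith)]
  refine le_trans ?_ (Real.add_one_le_exp _)
  rw [inv_le_iff_one_le_mul₀ (by linarith)]
  nlinarith

/-- Orthogonality of eigenfunctions of the skew-adjoint problem `σ = 0`: the integrand times `s -
s'` is the derivative of `r r' sin (θ - θ')`, which vanishes at both ends. -/
theorem IsPruefer.integral_mul_cos_sub_eq_zero (hL : 0 < L) (hc : Continuous d)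
    (h : IsPruefer L d s θ) (h' : IsPruefer L d s' θ') (hs : s ≠ s') {n m : ℤ}
    (hn : θ L = Real.pi * n) (hm : θ' L = Real.pi * m) :
    ∫ x in (0 : ℝ)..L, amplitude d 0 θ x * amplitude d 0 θ' x * Real.cos (θ x - θ' x) = 0 := by
  have hθ := h.continuous
  have hθ' := h'.continuous
  have hr := continuous_amplitude hc hθ 0
  have hr' := continuous_amplitude hc hθ' 0
  have h1 := intervalIntegral.integral_eq_sub_of_hasDerivAt (a := 0) (b := L)
    (f := fun x => amplitude d 0 θ x * amplitude d 0 θ' x * Real.sin (θ x - θ' x))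
    (f' := fun x => (s - s') *
      (amplitude d 0 θ x * amplitude d 0 θ' x * Real.cos (θ x - θ' x))) (fun x hx => ?_)
    ((by fun_prop : Continuous _).intervalIntegrable _ _)
  · have h2 : Real.sin (θ L - θ' L) = 0 := by
      rw [hn, hm, show Real.pi * n - Real.pi * m = ((n - m : ℤ) : ℝ) * Real.pi by
        push_cast; ring]
      exact Real.sin_int_mul_pi _
    rw [intervalIntegral.integral_const_mul] at h1
    simp only [h2, h.zero, h'.zero, sub_zero, Real.sin_zero, mul_zero, mul_eq_zero] at h1
    exact h1.resolve_left (sub_ne_zero.2 hs)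
  · rw [uIcc_of_le hL.le] at hx
    convert! ((hasDerivAt_amplitude hc hθ 0 x).mul (hasDerivAt_amplitude hc hθ' 0 x)).mul
      ((h.hasDerivAt x hx).sub (h'.hasDerivAt x hx)).sin using 1
    simp only [Pi.mul_apply, Pi.sub_apply]
    rw [Real.sin_sub, Real.cos_sub, Real.sin_two_mul, Real.sin_two_mul, Real.cos_two_mul',
      Real.cos_two_mul']
    have e1 := Real.sin_sq_add_cos_sq (θ x)
    have e2 := Real.sin_sq_add_cos_sq (θ' x)
    generalize Real.sin (θ x) = S at *
    generalize Real.cos (θ x) = C at *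
    generalize Real.sin (θ' x) = S' at *
    generalize Real.cos (θ' x) = C' at *
    linear_combination
      (amplitude d 0 θ x * amplitude d 0 θ' x * d x / 3 * (S * C' + C * S')) * (e1 - e2)

theorem abs_amplitude_sq_sub_one_le (hd : IsCoefficient L γ d) (hγ : γ * L ≤ 1 / 1000)
    {x : ℝ} (hx : x ∈ Icc 0 L) : |amplitude d 0 θ x ^ 2 - 1| ≤ 1 / 100 := by
  have h1 := hd.abs_amplitude_sub_one_le (θ := θ) (σ := 0) (by linarith) (by simp) hx
  rw [abs_le] at h1 ⊢
  constructor <;> nlinarith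

end Normalization

/-! ### Continuous branches of eigenvalues -/

/-- A continuous function on an interval with values near the integers that tends to an integer `n`
stays near `n`. -/
theorem abs_sub_int_le_of_continuousOn {γ₀ : ℝ} {f : ℝ → ℝ} (hf : ContinuousOn f (Ioo 0 γ₀))
    {n : ℤ} (hlim : Tendsto f (𝓝[>] 0) (𝓝 n)) (hint : ∀ t ∈ Ioo 0 γ₀, ∃ k : ℤ, |f t - k| ≤ 1 / 4)
    {t : ℝ} (ht : t ∈ Ioo 0 γ₀) {k : ℤ} (hk : |f t - k| ≤ 1 / 4) : k = n := by
  -- Half-integers are too far from every integer to be values of `f`, so by the intermediate value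
  -- theorem `f` cannot pass from one integer to another.
  have hhalf : ∀ u ∈ Ioo 0 γ₀, ∀ m : ℤ, f u ≠ m + 1 / 2 := by
    intro u hu m hm
    obtain ⟨k, hk⟩ := hint u hu
    rw [hm, abs_le] at hk
    have h1 : (m : ℝ) < k := by linarith
    have h2 : (k : ℝ) < m + 1 := by linarith
    have h3 : m < k := by exact_mod_cast h1
    have h4 : k < m + 1 := by exact_mod_cast h2
    omega
  have hev : ∀ᶠ u in 𝓝[>] (0 : ℝ), |f u - n| < 1 / 4 ∧ u ∈ Ioo 0 γ₀ := by
    refine (?_ : ∀ᶠ u in 𝓝[>] (0 : ℝ), |f u - n| < 1 / 4).and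
      (Ioo_mem_nhdsGT (ht.1.trans ht.2))
    have := Metric.tendsto_nhds.1 hlim (1 / 4) (by norm_num)
    simpa [Real.dist_eq] using this
  obtain ⟨u, hu, hu'⟩ := hev.exists
  rw [abs_lt] at hu
  rw [abs_le] at hk
  have hivt : ∀ {a b : ℝ}, a ∈ Ioo 0 γ₀ → b ∈ Ioo 0 γ₀ → Icc (f a) (f b) ⊆ f '' Ioo 0 γ₀ :=
    fun ha hb => isPreconnected_Ioo.intermediate_value ha hb hf
  rcases lt_trichotomy k n with h | h | h
  · have h1 : (k : ℝ) + 1 ≤ n := by exact_mod_cast h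
    obtain ⟨a, ha, ha'⟩ := hivt ht hu' (show (k : ℝ) + 1 / 2 ∈ Icc (f t) (f u) from
      ⟨by linarith, by linarith⟩)
    exact absurd ha' (hhalf a ha k)
  · exact h
  · have h1 : (n : ℝ) + 1 ≤ k := by exact_mod_cast h
    obtain ⟨a, ha, ha'⟩ := hivt hu' ht (show (n : ℝ) + 1 / 2 ∈ Icc (f u) (f t) from
      ⟨by linarith, by linarith⟩)
    exact absurd ha' (hhalf a ha n)

theorem pairing_inv_overlap {L : ℝ} {r θ : ℝ → ℝ} {n : ℤ} (h : overlap L r θ n ≠ 0) :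
    pairing L (fun x => (((overlap L r θ n)⁻¹ : ℝ) : ℂ) • polar r θ x) (psi0 L n) = 1 := by
  have h1 := pairing_smul_polar L (((overlap L r θ n)⁻¹ : ℝ) : ℂ) 1 r θ (fun _ => 1) (phase L n)
  simp only [map_one, mul_one, one_smul] at h1
  rw [psi0_eq_polar]
  refine h1.trans ?_
  rw [← overlap, ← Complex.ofReal_mul, inv_mul_cancel₀ h, Complex.ofReal_one]

/-- The adjoint problem for `conj μ` has system parameter `-conj μ`. For imaginary `μ` this is `μ`
itself, so both problems have the same Prüfer angle. -/
theorem neg_conj_I_mul (s : ℝ) : -conj (Complex.I * s) = Complex.I * s := by simp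

theorem mu0_eq (L : ℝ) (n : ℤ) : mu0 L n = Complex.I * ((Real.pi * n / L : ℝ) : ℂ) := by
  rw [mu0]
  push_cast
  ring

section Family

variable {L γ₀ : ℝ}

theorem mul_le_of_mem_Ioo {γ c : ℝ} (hL : 0 < L) (hγ₀ : γ₀ * L ≤ c) (hγ : γ ∈ Ioo 0 γ₀) :
    γ * L ≤ c :=
  (mul_le_mul_of_nonneg_right hγ.2.le hL.le).trans hγ₀

theorem exists_isPerturbedEigenfamily (hL : 0 < L) (h0 : 0 < γ₀) (hγ₀ : γ₀ * L ≤ 1 / 1000) :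
    ∃ (μ : ℤ → ℝ → ℂ) (ψ χ : ℤ → ℝ → ℝ → C2), IsPerturbedEigenfamily L γ₀ μ ψ χ := by
  have hd : ∀ γ ∈ Ioo 0 γ₀, IsCoefficient L γ (deltaExt L γ) := fun γ hγ =>
    isCoefficient_deltaExt hL hγ.1 (mul_le_of_mem_Ioo hL (by linarith) hγ)
  -- The implication allows `s` and `θ` to be chosen for every real `γ`; their values outside the
  -- interval play no role.
  have hex : ∀ (n : ℤ) (γ : ℝ), ∃ (s : ℝ) (θ : ℝ → ℝ), γ ∈ Ioo 0 γ₀ →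
      IsPruefer L (deltaExt L γ) s θ ∧ θ L = Real.pi * n := by
    intro n γ
    by_cases hγ : γ ∈ Ioo 0 γ₀
    · obtain ⟨s, θ, h⟩ := exists_isPruefer_apply_eq hL (hd γ hγ).continuous (hd γ hγ).abs_apply_le
        (Real.pi * n)
      exact ⟨s, θ, fun _ => h⟩
    · exact ⟨0, 0, fun h => absurd h hγ⟩
  choose s θ hs using hex
  have hov : ∀ σ : ℝ, |σ| ≤ 1 → ∀ n, ∀ γ ∈ Ioo 0 γ₀,
      overlap L (amplitude (deltaExt L γ) σ (θ n γ)) (θ n γ) n ≠ 0 := by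
    intro σ hσ n γ hγ h0
    have := (hd γ hγ).abs_overlap_sub_one_le hL (mul_le_of_mem_Ioo hL hγ₀ hγ) hσ (hs n γ hγ).1
      (hs n γ hγ).2
    rw [h0] at this
    norm_num at this
  have hsys : ∀ σ : ℝ, |σ| ≤ 1 → ∀ n, ∀ γ ∈ Ioo 0 γ₀,
      IsSystemEigenfunction L (deltaExt L γ) σ (Complex.I * s n γ) fun x =>
        (((overlap L (amplitude (deltaExt L γ) σ (θ n γ)) (θ n γ) n)⁻¹ : ℝ) : ℂ) •
          polar (amplitude (deltaExt L γ) σ (θ n γ)) (θ n γ) x := by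
    intro σ hσ n γ hγ
    refine (hs n γ hγ).1.isSystemEigenfunction hL (hd γ hγ).continuous (hs n γ hγ).2 ?_
    exact_mod_cast inv_ne_zero (hov σ hσ n γ hγ)
  refine ⟨fun n γ => Complex.I * s n γ,
    fun n γ x => (((overlap L (amplitude (deltaExt L γ) (-1) (θ n γ)) (θ n γ) n)⁻¹ : ℝ) : ℂ) •
      polar (amplitude (deltaExt L γ) (-1) (θ n γ)) (θ n γ) x,
    fun n γ x => (((overlap L (amplitude (deltaExt L γ) 1 (θ n γ)) (θ n γ) n)⁻¹ : ℝ) : ℂ) •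
      polar (amplitude (deltaExt L γ) 1 (θ n γ)) (θ n γ) x, ?_, ?_, ?_, ?_, ?_, ?_⟩
  · intro n
    have h1 : ContinuousOn (s n) (Ioo 0 γ₀) := by
      intro γ hγ
      refine Metric.tendsto_nhds.2 fun ε hε => ?_
      filter_upwards [eventually_abs_deltaExt_sub_lt hL (by linarith) hε hγ,
        self_mem_nhdsWithin] with γ' h1 hγ'
      have h2 := (hs n γ' hγ').1.abs_sub_le hL (hd γ' hγ').continuous (hd γ hγ).continuous
        (hs n γ hγ).1 (fun x hx => (h1 x hx).le) ((hs n γ' hγ').2.trans (hs n γ hγ).2.symm)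
      rw [Real.dist_eq]
      linarith
    exact continuousOn_const.mul (Complex.continuous_ofReal.comp_continuousOn h1)
  · intro n
    rw [mu0_eq]
    refine Tendsto.const_mul _ ((Complex.continuous_ofReal.tendsto _).comp ?_)
    rw [tendsto_iff_norm_sub_tendsto_zero]
    refine squeeze_zero' (g := fun γ => γ / 2) (Eventually.of_forall fun _ => norm_nonneg _) ?_ ?_
    · filter_upwards [Ioo_mem_nhdsGT h0] with γ hγ
      exact (hd γ hγ).abs_sub_spectral_le hL (hs n γ hγ).1 (hs n γ hγ).2
    · have : Tendsto (fun γ : ℝ => γ / 2) (𝓝 0) (𝓝 (0 / 2)) := tendsto_id.div_const 2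
      rw [zero_div] at this
      exact this.mono_left nhdsWithin_le_nhds
  · intro n γ hγ
    exact (isEigenfunction_S0_iff fun x hx => deltaExt_eq hx).2 (hsys (-1) (by simp) n γ hγ)
  · intro n γ hγ
    refine (isEigenfunction_S0Adj_iff fun x hx => deltaExt_eq hx).2 ?_
    rw [neg_conj_I_mul]
    exact hsys 1 (by simp) n γ hγ
  · intro n γ hγ
    exact pairing_inv_overlap (hov (-1) (by simp) n γ hγ)
  · intro n γ hγ
    rw [← pairing_conj_symm, pairing_inv_overlap (hov 1 (by simp) n γ hγ), map_one]

/-- The members of a perturbed eigenfamily in polar form. -/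
theorem IsPerturbedEigenfamily.exists_polar {μ : ℤ → ℝ → ℂ} {ψ χ : ℤ → ℝ → ℝ → C2} (hL : 0 < L)
    (hγ₀ : γ₀ * L ≤ 1 / 1000) (h : IsPerturbedEigenfamily L γ₀ μ ψ χ) {γ : ℝ}
    (hγ : γ ∈ Ioo 0 γ₀) (n : ℤ) :
    ∃ (s : ℝ) (θ : ℝ → ℝ), IsPruefer L (deltaExt L γ) s θ ∧ θ L = Real.pi * n ∧
      (n = 0 → θ = 0) ∧ μ n γ = Complex.I * s ∧
      (∀ x ∈ Icc 0 L, ψ n γ x =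
        (((overlap L (amplitude (deltaExt L γ) (-1) θ) θ n)⁻¹ : ℝ) : ℂ) •
          polar (amplitude (deltaExt L γ) (-1) θ) θ x) ∧
      ∀ x ∈ Icc 0 L, χ n γ x =
        (((overlap L (amplitude (deltaExt L γ) 1 θ) θ n)⁻¹ : ℝ) : ℂ) •
          polar (amplitude (deltaExt L γ) 1 θ) θ x := by
  have hd : ∀ t ∈ Ioo 0 γ₀, IsCoefficient L t (deltaExt L t) := fun t ht =>
    isCoefficient_deltaExt hL ht.1 (mul_le_of_mem_Ioo hL (by linarith) ht)
  have hψ : ∀ t ∈ Ioo 0 γ₀, μ n t = Complex.I * (μ n t).im ∧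
      IsSystemEigenfunction L (deltaExt L t) (-1) (Complex.I * (μ n t).im) (ψ n t) := by
    intro t ht
    have h1 := (isEigenfunction_S0_iff fun x hx => deltaExt_eq hx).1 (h.eigen n t ht)
    have h2 := h1.re_eq_zero hL (hd t ht).continuous
    have h3 : μ n t = Complex.I * (μ n t).im := by
      refine Complex.ext ?_ ?_ <;> simp [h2]
    exact ⟨h3, h3 ▸ h1⟩
  -- In units of `π / L` the eigenvalue is within `1 / 4` of the integer that its Prüfer angle
  -- determines; a priori this integer may depend on `t`.
  have hint : ∀ t ∈ Ioo 0 γ₀, ∀ θ, IsPruefer L (deltaExt L t) (μ n t).im θ →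
      ∃ k : ℤ, θ L = Real.pi * k ∧ |(μ n t).im * L / Real.pi - k| ≤ 1 / 4 := by
    intro t ht θ hθ
    obtain ⟨⟨k, hk⟩, -⟩ := (hψ t ht).2.exists_eq_smul_polar hL (hd t ht).continuous hθ
    refine ⟨k, hk, ?_⟩
    have h1 := (hd t ht).abs_sub_spectral_le hL hθ hk
    have hpi := Real.pi_gt_three
    have h2 : (μ n t).im * L / Real.pi - k =
        ((μ n t).im - Real.pi * k / L) * L / Real.pi := by
      field_simp
    rw [h2, abs_div, abs_mul, abs_of_pos hL, abs_of_pos Real.pi_pos, div_le_iff₀ Real.pi_pos]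
    have h3 := mul_le_of_mem_Ioo hL hγ₀ ht
    nlinarith
  have hpr : ∀ t ∈ Ioo 0 γ₀, ∀ s, ∃ θ, IsPruefer L (deltaExt L t) s θ := fun t ht s =>
    exists_isPruefer hL.le (hd t ht).continuous (hd t ht).abs_apply_le s
  have hcont : ContinuousOn (fun t => (μ n t).im * L / Real.pi) (Ioo 0 γ₀) :=
    ((Complex.continuous_im.comp_continuousOn (h.continuousOn n)).mul continuousOn_const).div_const _
  have hlim : Tendsto (fun t => (μ n t).im * L / Real.pi) (𝓝[>] 0) (𝓝 n) := by
    have h1 := (((Complex.continuous_im.tendsto _).comp (h.tendsto_zero n)).mul_const L).div_const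
      Real.pi
    have h2 : (mu0 L n).im * L / Real.pi = n := by
      have := Real.pi_ne_zero
      rw [mu0_eq, Complex.I_mul_im, Complex.ofReal_re]
      field_simp
    rw [h2] at h1
    exact h1
  have hend : ∀ θ, IsPruefer L (deltaExt L γ) (μ n γ).im θ → θ L = Real.pi * n := by
    intro θ hθ
    obtain ⟨k, hk, hk'⟩ := hint γ hγ θ hθ
    rw [hk, abs_sub_int_le_of_continuousOn hcont hlim (fun t ht => ?_) hγ hk']
    obtain ⟨θ', hθ'⟩ := hpr t ht (μ n t).im
    obtain ⟨k', -, hk'⟩ := hint t ht θ' hθ'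
    exact ⟨k', hk'⟩
  -- For `n = 0` the zero function is a Prüfer angle for `s = 0` with the same end value; comparison
  -- with `η = 0` forces the eigenvalue to be `0`.
  obtain ⟨θ, hθ, hθ0⟩ : ∃ θ, IsPruefer L (deltaExt L γ) (μ n γ).im θ ∧ (n = 0 → θ = 0) := by
    obtain ⟨θ, hθ⟩ := hpr γ hγ (μ n γ).im
    by_cases hn : n = 0
    · have hz : IsPruefer L (deltaExt L γ) 0 (0 : ℝ → ℝ) :=
        ⟨continuous_const, rfl, fun x _ => by simp⟩
      have h1 := hθ.abs_sub_le (η := 0) hL (hd γ hγ).continuous (hd γ hγ).continuous hz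
        (by simp) (by rw [hend θ hθ, hn]; simp)
      have h2 : (μ n γ).im = 0 := by
        rw [zero_div, sub_zero] at h1
        exact abs_nonpos_iff.1 h1
      exact ⟨0, h2 ▸ hz, fun _ => rfl⟩
    · exact ⟨θ, hθ, fun h0 => absurd h0 hn⟩
  refine ⟨(μ n γ).im, θ, hθ, hend θ hθ, hθ0, (hψ γ hγ).1,
    (hψ γ hγ).2.eq_smul_polar_of_pairing hL (hd γ hγ) hθ (h.norm_psi n γ hγ), ?_⟩
  have h1 := (isEigenfunction_S0Adj_iff fun x hx => deltaExt_eq hx).1 (h.eigen_adj n γ hγ)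
  rw [(hψ γ hγ).1, neg_conj_I_mul] at h1
  refine h1.eq_smul_polar_of_pairing hL (hd γ hγ) hθ ?_
  rw [← pairing_conj_symm, h.norm_chi n γ hγ, map_one]

end Family

/-! ### Pairings, moments and the Riesz basis at fixed `γ` -/

section Fixed

variable {L γ : ℝ} {d : ℝ → ℝ}

theorem inv_mem_of_abs_sub_one_le {p : ℝ} (hp : |p - 1| ≤ 1 / 100) :
    p⁻¹ ∈ Icc (95 / 100 : ℝ) (105 / 100) := by
  rw [abs_le] at hp
  have h0 : 0 < p := by linarith
  constructor
  · rw [le_inv_comm₀ (by norm_num) h0]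
    norm_num
    linarith
  · rw [inv_le_comm₀ h0 (by norm_num)]
    norm_num
    linarith

theorem amplitude_eq_exp_mul (hc : Continuous d) {θ : ℝ → ℝ} (hθ : Continuous θ) (σ x : ℝ) :
    amplitude d σ θ x = Real.exp (σ * ∫ t in (0 : ℝ)..x, d t) * amplitude d 0 θ x := by
  rw [amplitude, amplitude, ← Real.exp_add, ← intervalIntegral.integral_const_mul,
    ← intervalIntegral.integral_add ((hc.const_mul σ).intervalIntegrable _ _)
      ((continuous_log_amplitude hc hθ 0).intervalIntegrable _ _)]
  congr 2
  ext t
  ring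

theorem pairing_polar_self_eq (L a b : ℝ) {r r' q θ : ℝ → ℝ}
    (h : ∀ x, r x * r' x = q x ^ 2) :
    pairing L (fun x => (a : ℂ) • polar r θ x) (fun x => (b : ℂ) • polar r' θ x) =
      ((a * b * (1 / L * ∫ x in (0 : ℝ)..L, q x ^ 2) : ℝ) : ℂ) := by
  rw [pairing_smul_polar]
  simp only [sub_self, Real.cos_zero, mul_one, h, Complex.conj_ofReal]
  push_cast
  ring

theorem IsCoefficient.abs_mean_sq_sub_one_le (hd : IsCoefficient L γ d) (hL : 0 < L)
    (hγ : γ * L ≤ 1 / 1000) {θ : ℝ → ℝ} (hθ : Continuous θ) :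
    |1 / L * (∫ x in (0 : ℝ)..L, amplitude d 0 θ x ^ 2) - 1| ≤ 1 / 100 :=
  abs_mean_sub_one_le hL ((continuous_amplitude hd.continuous hθ 0).pow 2) fun _ hx =>
    abs_amplitude_sq_sub_one_le hd hγ hx

theorem IsCoefficient.norm_pairing_mem (hd : IsCoefficient L γ d) (hL : 0 < L)
    (hγ : γ * L ≤ 1 / 1000) {s : ℝ} {θ : ℝ → ℝ} (h : IsPruefer L d s θ) {n : ℤ}
    (hn : θ L = Real.pi * n) {ψ χ : ℝ → C2}
    (hψ : ∀ x ∈ Icc 0 L, ψ x = (((overlap L (amplitude d (-1) θ) θ n)⁻¹ : ℝ) : ℂ) •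
      polar (amplitude d (-1) θ) θ x)
    (hχ : ∀ x ∈ Icc 0 L, χ x = (((overlap L (amplitude d 1 θ) θ n)⁻¹ : ℝ) : ℂ) •
      polar (amplitude d 1 θ) θ x) :
    ‖pairing L ψ χ‖ ∈ Ioo (1 / 2 : ℝ) 2 := by
  have h1 := inv_mem_of_abs_sub_one_le
    (hd.abs_overlap_sub_one_le (σ := -1) hL hγ (by simp) h hn)
  have h2 := inv_mem_of_abs_sub_one_le (hd.abs_overlap_sub_one_le (σ := 1) hL hγ (by simp) h hn)
  rw [pairing_congr hL.le hψ hχ, pairing_polar_self_eq L (q := amplitude d 0 θ) _ _ fun x => by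
    rw [amplitude_mul_amplitude hd.continuous h.continuous, neg_add_cancel, zero_div],
    Complex.norm_real]
  have h3 := abs_le.1 (hd.abs_mean_sq_sub_one_le hL hγ h.continuous)
  generalize (overlap L (amplitude d (-1) θ) θ n)⁻¹ = a at *
  generalize (overlap L (amplitude d 1 θ) θ n)⁻¹ = b at *
  generalize 1 / L * ∫ x in (0 : ℝ)..L, amplitude d 0 θ x ^ 2 = c at *
  have hab : 9 / 10 ≤ a * b ∧ a * b ≤ 12 / 10 := by
    constructor <;> nlinarith [h1.1, h1.2, h2.1, h2.2]
  rw [Real.norm_of_nonneg (mul_nonneg (by linarith) (by linarith))]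
  constructor <;> nlinarith

/-- In the moment identity the right-hand side lies between `γ L / 6` and `2`, and `|s|` between `3
|n| / L` and `4 |n| / L`. The normalization factor is within `5` percent of `1`, and `0.95 / 24 > 1
/ 100`, `1.05 · 2 / 3 < 1`. The lower bound carries a factor `γ` because for even `n` the
unperturbed moment is zero. -/
theorem IsCoefficient.norm_moment_mem (hd : IsCoefficient L γ d) (hL : 0 < L) (hγ0 : 0 < γ)
    (hγ : γ * L ≤ 1 / 1000) {s : ℝ} {θ : ℝ → ℝ} (h : IsPruefer L d s θ) {n : ℤ}
    (hn : θ L = Real.pi * n) (h0 : n ≠ 0) {χ : ℝ → C2}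
    (hχ : ∀ x ∈ Icc 0 L, χ x = (((overlap L (amplitude d 1 θ) θ n)⁻¹ : ℝ) : ℂ) •
      polar (amplitude d 1 θ) θ x) :
    γ * (L / 100 / |(n : ℝ)|) < ‖pairing L χ controlProfile‖ ∧
      ‖pairing L χ controlProfile‖ < 1 / |(n : ℝ)| := by
  have h2 := inv_mem_of_abs_sub_one_le (hd.abs_overlap_sub_one_le (σ := 1) hL hγ (by simp) h hn)
  have hs := hd.mul_abs_le hL (by linarith) h hn h0
  have hn0 : 0 < |(n : ℝ)| := by positivity
  have hs0 : 0 < |s| := lt_of_lt_of_le (by positivity) hs.1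
  have hint := h.mul_integral_amplitude_sin hL hd (abs_pos.1 hs0) hn
  have hamp := hd.amplitude_one_le hL (by linarith) h.continuous
  have hpos := amplitude_pos d θ 1 L
  rw [pairing_congr hL.le hχ fun _ _ => rfl, pairing_smul_polar_controlProfile, norm_mul, norm_mul,
    Complex.norm_I, mul_one, Complex.norm_real, Complex.norm_real, norm_mul, Real.norm_eq_abs,
    Real.norm_eq_abs, Real.norm_eq_abs, abs_of_pos (show 0 < 1 / L by positivity),
    abs_of_pos (show 0 < (overlap L (amplitude d 1 θ) θ n)⁻¹ by linarith [h2.1])]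
  generalize (overlap L (amplitude d 1 θ) θ n)⁻¹ = b at *
  generalize (∫ x in (0 : ℝ)..L, amplitude d 1 θ x * Real.sin (θ x)) = J at *
  have hJ : γ * L / 6 ≤ |s| * |J| ∧ |s| * |J| ≤ 2 := by
    rw [← abs_mul, hint]
    have h3 : amplitude d 1 θ L * |Real.cos (θ L)| ≤ amplitude d 1 θ L * 1 :=
      mul_le_mul_of_nonneg_left (Real.abs_cos_le_one _) hpos.le
    have h4 : |amplitude d 1 θ L * Real.cos (θ L)| ≤ 1 - γ * L / 6 := by
      rw [abs_mul, abs_of_pos hpos]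
      linarith
    have h5 := abs_le.1 h4
    have h6 : 0 < γ * L := by positivity
    rw [abs_of_nonneg (by linarith)]
    constructor <;> linarith
  have hJ1 : γ * L ^ 2 / 24 ≤ |(n : ℝ)| * |J| := by
    have h3 : |s| * L ≤ 4 * |(n : ℝ)| := (le_div_iff₀ hL).1 hs.2
    have h4 := mul_le_mul_of_nonneg_right h3 (abs_nonneg J)
    have h5 := mul_le_mul_of_nonneg_right hJ.1 hL.le
    nlinarith
  have hJ2 : |(n : ℝ)| * |J| ≤ 2 / 3 * L := by
    have h3 : 3 * |(n : ℝ)| ≤ |s| * L := (div_le_iff₀ hL).1 hs.1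
    have h4 := mul_le_mul_of_nonneg_right h3 (abs_nonneg J)
    have h5 := mul_le_mul_of_nonneg_right hJ.2 hL.le
    nlinarith
  have hγL : 0 < γ * L ^ 2 := by positivity
  constructor
  · rw [show γ * (L / 100 / |(n : ℝ)|) = γ * L ^ 2 / 100 / (L * |(n : ℝ)|) by field_simp,
      div_lt_iff₀ (by positivity), show b * (1 / L * |J|) * (L * |(n : ℝ)|) = b * (|(n : ℝ)| * |J|) by
        field_simp]
    have h3 := mul_le_mul h2.1 hJ1 (by positivity) (by linarith [h2.1])
    linarith
  · rw [lt_div_iff₀ hn0, show b * (1 / L * |J|) * |(n : ℝ)| = b * (|(n : ℝ)| * |J|) / L by ring,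
      div_lt_iff₀ hL]
    have h3 := mul_le_mul h2.2 hJ2 (by positivity) (by norm_num)
    linarith

theorem summable_one_div_one_add_sq : Summable fun n : ℤ => 1 / (1 + (n : ℝ) ^ 2) := by
  refine Summable.of_norm_bounded_eventually (g := fun n : ℤ => 1 / (n : ℝ) ^ 2)
    (Real.summable_one_div_int_pow.2 one_lt_two) ?_
  filter_upwards [eventually_cofinite_ne (0 : ℤ)] with n hn
  have hn0 : 0 < (n : ℝ) ^ 2 := by positivity
  rw [Real.norm_of_nonneg (by positivity)]
  exact one_div_le_one_div_of_le hn0 (by linarith)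

/-- The denominator `1 + n²` treats `n = 0` together with the rest. The constant `50 = 2 (4 + 1)²`
comes from `n = 0`, where the bounds without decay are used. -/
theorem IsCoefficient.norm_polar_sub_psi0_sq_le (hd : IsCoefficient L γ d) (hL : 0 < L)
    (hγ : γ * L ≤ 1 / 1000) {s : ℝ} {θ : ℝ → ℝ} (h : IsPruefer L d s θ) {n : ℤ}
    (hn : θ L = Real.pi * n) {x : ℝ} (hx : x ∈ Icc 0 L) :
    ‖polar (amplitude d 0 θ) θ x - psi0 L n x‖ ^ 2 ≤ 50 * (γ * L) ^ 2 * (1 / (1 + (n : ℝ) ^ 2)) := by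
  have hε : 0 ≤ γ * L := mul_nonneg hd.gamma_nonneg hL.le
  rw [psi0_eq_polar]
  refine (norm_polar_sub_sq_le _ _ _ _).trans ?_
  by_cases h0 : n = 0
  · have h1 := hd.abs_amplitude_sub_one_le (θ := θ) (σ := 0) (by linarith) (by simp) hx
    have h2 := hd.abs_angle_sub_phase_le hL h hn hx
    have h3 := pow_le_pow_left₀ (by positivity) (add_le_add h1 h2) 2
    rw [h0] at h3 ⊢
    simp only [Int.cast_zero]
    linarith
  · have hn1 : (1 : ℝ) ≤ (n : ℝ) ^ 2 := by
      have : (1 : ℝ) ≤ |(n : ℝ)| := by exact_mod_cast Int.one_le_abs h0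
      rw [← sq_abs]
      exact one_le_pow₀ this
    have h1 := hd.abs_amplitude_sub_one_le_div hL (by linarith) h hn h0 hx
    have h2 := hd.abs_angle_sub_phase_le_div hL (by linarith) h hn h0 hx
    have h3 := pow_le_pow_left₀ (by positivity) (add_le_add h1 h2) 2
    rw [← add_div, div_pow, sq_abs] at h3
    have h4 : (γ * L + γ * L) ^ 2 / (n : ℝ) ^ 2 ≤ 25 * (γ * L) ^ 2 * (1 / (1 + (n : ℝ) ^ 2)) := by
      rw [mul_one_div, div_le_div_iff₀ (by linarith) (by linarith)]
      nlinarith [sq_nonneg (γ * L)]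
    linarith

theorem IsCoefficient.isRieszBasisL2 (hd : IsCoefficient L γ d) (hL : 0 < L)
    (hγ : γ * L ≤ 1 / 1000)
    (hsum : 25 * (γ * L) ^ 2 * ∑' n : ℤ, 1 / (1 + (n : ℝ) ^ 2) < 1) {s : ℤ → ℝ} {θ : ℤ → ℝ → ℝ}
    (h : ∀ n, IsPruefer L d (s n) (θ n)) (hn : ∀ n, θ n L = Real.pi * n) {ψ : ℤ → ℝ → C2}
    (hψ : ∀ n, ∀ x ∈ Icc 0 L, ψ n x =
      (((overlap L (amplitude d (-1) (θ n)) (θ n) n)⁻¹ : ℝ) : ℂ) •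
        polar (amplitude d (-1) (θ n)) (θ n) x) : IsRieszBasisL2 L ψ := by
  have hc := hd.continuous
  have hθ := fun n => (h n).continuous
  have hpc : ∀ σ n, Continuous (polar (amplitude d σ (θ n)) (θ n)) := fun σ n =>
    continuous_polar (continuous_amplitude hc (hθ n) σ) (hθ n)
  have hp := fun n => memLp_of_continuous L (hpc 0 n)
  have hp0 : ∀ n, MemLp (psi0 L n) 2 (volume.restrict (Ioo (0 : ℝ) L)) := fun n => by
    rw [psi0_eq_polar]
    exact memLp_of_continuous L (continuous_polar continuous_const (continuous_phase L n))
  let a : ℤ → ℝ := fun n => (overlap L (amplitude d (-1) (θ n)) (θ n) n)⁻¹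
  have ha : ∀ n, a n ∈ Icc (95 / 100 : ℝ) (105 / 100) := fun n => inv_mem_of_abs_sub_one_le
    (hd.abs_overlap_sub_one_le (σ := -1) hL hγ (by simp) (h n) (hn n))
  -- This weight carries the orthogonal functions for `σ = 0` to those for `σ = -1`; it is the same
  -- for every `n`, hence one multiplication operator.
  let m : ℝ → ℂ := fun x => ((Real.exp (-1 * ∫ t in (0 : ℝ)..x, d t) : ℝ) : ℂ)
  have hm : Continuous m := by
    have := intervalIntegral.continuous_primitive (μ := volume) (fun a b => hc.intervalIntegrable a b) 0
    exact Complex.continuous_ofReal.comp (Real.continuous_exp.comp (continuous_const.mul this))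
  have hm0 : ∀ x, m x ≠ 0 := fun x => Complex.ofReal_ne_zero.2 (Real.exp_pos _).ne'
  obtain ⟨A, hA⟩ := exists_mul_equiv L hm hm0
  have hψae : ∀ n, (fun x => m x • (a n : ℂ) • polar (amplitude d 0 (θ n)) (θ n) x)
      =ᵐ[volume.restrict (Ioo (0 : ℝ) L)] ψ n := by
    intro n
    filter_upwards [ae_restrict_mem measurableSet_Ioo] with x hx
    rw [hψ n x (Ioo_subset_Icc_self hx), smul_comm]
    congr 1
    ext i
    fin_cases i <;> simp [polar, m, amplitude_eq_exp_mul hc (hθ n) (-1) x, mul_assoc]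
  have hvcont : ∀ n, Continuous fun x => (a n : ℂ) • polar (amplitude d 0 (θ n)) (θ n) x :=
    fun n => (hpc 0 n).const_smul (a n : ℂ)
  have hmul : ∀ n, MemLp (fun x => m x • (a n : ℂ) • polar (amplitude d 0 (θ n)) (θ n) x) 2
      (volume.restrict (Ioo (0 : ℝ) L)) := fun n => memLp_of_continuous L (hm.smul (hvcont n))
  have hψL : ∀ n, MemLp (ψ n) 2 (volume.restrict (Ioo (0 : ℝ) L)) := fun n =>
    (hmul n).ae_eq (hψae n)
  have hψA : ∀ n, (hψL n).toLp (ψ n) =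
      A ((a n : ℂ) • (hp n).toLp (polar (amplitude d 0 (θ n)) (θ n))) := by
    intro n
    have h1 := hA _ (memLp_of_continuous L (hvcont n)) (hmul n)
    have h2 : (memLp_of_continuous L (hvcont n)).toLp _ =
        (a n : ℂ) • (hp n).toLp (polar (amplitude d 0 (θ n)) (θ n)) := rfl
    rw [← h2, h1]
    exact (MemLp.toLp_congr _ _ (hψae n)).symm
  have hinner : ∀ n k, inner ℂ ((hp n).toLp (polar (amplitude d 0 (θ n)) (θ n)))
      ((hp k).toLp (polar (amplitude d 0 (θ k)) (θ k))) =
      ((2 * ∫ x in (0 : ℝ)..L, amplitude d 0 (θ k) x * amplitude d 0 (θ n) x *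
        Real.cos (θ k x - θ n x) : ℝ) : ℂ) := by
    intro n k
    rw [inner_toLp_toLp hL]
    have h1 := pairing_smul_polar L 1 1 (amplitude d 0 (θ k)) (θ k) (amplitude d 0 (θ n)) (θ n)
    simp only [one_smul, map_one, one_mul] at h1
    rw [show pairing L (polar (amplitude d 0 (θ k)) (θ k)) (polar (amplitude d 0 (θ n)) (θ n)) = _
      from h1]
    have : (L : ℂ) ≠ 0 := by exact_mod_cast hL.ne'
    push_cast
    field_simp
  -- Equal spectral parameters would put both end values `π n` and `π k` within `γ L / 2` of `s L`,
  -- although they differ by at least `π`.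
  have hne : ∀ n k, n ≠ k → s n ≠ s k := by
    intro n k hnk heq
    have h1 := (h n).abs_sub_mul_le hd.abs_apply_le (right_mem_Icc.2 hL.le)
    have h2 := (h k).abs_sub_mul_le hd.abs_apply_le (right_mem_Icc.2 hL.le)
    rw [hn, heq] at h1
    rw [hn] at h2
    have h3 : |Real.pi * n - Real.pi * k| ≤ 1 := by
      have := abs_sub (Real.pi * n - s k * L) (Real.pi * k - s k * L)
      rw [sub_sub_sub_cancel_right] at this
      linarith
    rw [← mul_sub, abs_mul, abs_of_pos Real.pi_pos] at h3
    have h4 : (1 : ℝ) ≤ |(n : ℝ) - k| := by exact_mod_cast Int.one_le_abs (sub_ne_zero.2 hnk)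
    nlinarith [Real.pi_gt_three]
  have hortho : Pairwise fun n k => inner ℂ ((hp n).toLp (polar (amplitude d 0 (θ n)) (θ n)))
      ((hp k).toLp (polar (amplitude d 0 (θ k)) (θ k))) = 0 := by
    intro n k hnk
    rw [hinner, (h k).integral_mul_cos_sub_eq_zero hL hc (h n) (hne k n hnk.symm) (hn k) (hn n)]
    simp
  have hnorm : ∀ n, ‖(hp n).toLp (polar (amplitude d 0 (θ n)) (θ n))‖ ^ 2 ∈ Icc L (4 * L) := by
    intro n
    have h1 := hinner n n
    have h2 := abs_le.1 (hd.abs_mean_sq_sub_one_le hL hγ (hθ n))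
    simp only [sub_self, Real.cos_zero, mul_one, ← sq] at h1
    rw [inner_self_eq_norm_sq_to_K] at h1
    have h3 : ‖(hp n).toLp (polar (amplitude d 0 (θ n)) (θ n))‖ ^ 2 =
        2 * ∫ x in (0 : ℝ)..L, amplitude d 0 (θ n) x ^ 2 :=
      Complex.ofReal_injective (by simpa using h1)
    rw [h3]
    generalize (∫ x in (0 : ℝ)..L, amplitude d 0 (θ n) x ^ 2) = J at *
    have h4 : 1 / L * J = J / L := by ring
    rw [h4] at h2
    have h5 : 1 / 2 ≤ J / L := by linarith
    have h6 : J / L ≤ 2 := by linarith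
    rw [le_div_iff₀ hL] at h5
    rw [div_le_iff₀ hL] at h6
    constructor <;> linarith
  have hnorm' : ∀ n, ‖(hp n).toLp (polar (amplitude d 0 (θ n)) (θ n))‖ ∈
      Icc (Real.sqrt L) (2 * Real.sqrt L) := by
    intro n
    refine ⟨Real.sqrt_le_iff.2 ⟨norm_nonneg _, (hnorm n).1⟩, ?_⟩
    refine abs_le_of_sq_le_sq' ?_ (by positivity) |>.2
    rw [mul_pow, Real.sq_sqrt hL.le]
    linarith [(hnorm n).2]
  have hclose : ∀ n, ‖(hp n).toLp (polar (amplitude d 0 (θ n)) (θ n)) - (hp0 n).toLp (psi0 L n)‖ ^ 2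
      ≤ 50 * (γ * L) ^ 2 * L * (1 / (1 + (n : ℝ) ^ 2)) := by
    intro n
    rw [← MemLp.toLp_sub]
    refine (norm_toLp_sq_le hL _ fun x hx => hd.norm_polar_sub_psi0_sq_le hL hγ (h n) (hn n)
      (Ioo_subset_Icc_self hx)).trans (le_of_eq ?_)
    ring
  have hS := summable_one_div_one_add_sq.mul_left (50 * (γ * L) ^ 2 * L)
  have hS' := Summable.of_nonneg_of_le (fun n => sq_nonneg _) hclose hS
  refine ⟨hψL, ?_⟩
  simp only [hψA]
  have hsq := Real.sqrt_pos.2 hL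
  have hna : ∀ n, ‖(a n : ℂ)‖ = a n := fun n => by
    rw [Complex.norm_real, Real.norm_of_nonneg (by linarith [(ha n).1])]
  refine isRieszBasis_of_orthogonal hortho (fun f hf => ?_) (m := Real.sqrt L / 2)
    (M := 4 * Real.sqrt L) (by positivity) (fun n => ?_) (fun n => ?_) A
  -- The Parseval constant is `2 L`, as `psi0` has pointwise norm squared `2`; the total defect is
  -- below it exactly by `hsum`.
  · refine eq_zero_of_inner_eq_zero (hasSum_norm_inner_psi0_sq hL hp0) hS' ?_ hf
    refine (hS'.tsum_le_tsum hclose hS).trans_lt ?_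
    rw [tsum_mul_left]
    nlinarith
  · rw [hna]
    nlinarith [(ha n).1, (hnorm' n).1]
  · rw [hna]
    nlinarith [(ha n).1, (ha n).2, (hnorm' n).1, (hnorm' n).2]

end Fixed

end WaterTank

end

/-! ### Choice of constants and conclusion -/

theorem mainTheorem4 (L : ℝ) (hL : 0 < L) :
    ∃ γ₀ c C : ℝ, 0 < γ₀ ∧ γ₀ < 2 / L ∧ 0 < c ∧ 0 < C ∧
      (∃ (μ : ℤ → ℝ → ℂ) (ψ χ : ℤ → ℝ → ℝ → WaterTank.C2),
        WaterTank.IsPerturbedEigenfamily L γ₀ μ ψ χ) ∧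
      ∀ (μ : ℤ → ℝ → ℂ) (ψ χ : ℤ → ℝ → ℝ → WaterTank.C2),
        WaterTank.IsPerturbedEigenfamily L γ₀ μ ψ χ →
        ∀ γ ∈ Set.Ioo 0 γ₀,
          WaterTank.IsRieszBasisL2 L (fun n : ℤ => ψ n γ) ∧
          (∀ n : ℤ, ‖WaterTank.pairing L (ψ n γ) (χ n γ)‖ ∈ Set.Ioo (1 / 2 : ℝ) 2) ∧
          (∀ n : ℤ, ‖μ n γ - WaterTank.mu0 L n‖ < 1 / (4 * L)) ∧
          WaterTank.moment L χ 0 γ = 0 ∧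
          ∀ n : ℤ, n ≠ 0 →
            γ * (c / |(n : ℝ)|) < ‖WaterTank.moment L χ n γ‖ ∧
            ‖WaterTank.moment L χ n γ‖ < C / |(n : ℝ)| := by
  let S : ℝ := ∑' n : ℤ, 1 / (1 + (n : ℝ) ^ 2)
  have hS : 0 ≤ S := tsum_nonneg fun n => by positivity
  -- `ε` bounds `γ L`: the first entry serves the pointwise estimates, the second the completeness
  -- condition `25 (γ L)² S < 1`.
  let ε : ℝ := min (1 / 1000) (1 / (25 * (S + 1)))
  have hε : 0 < ε := lt_min (by norm_num) (by positivity)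
  have hε1 : ε ≤ 1 / 1000 := min_le_left _ _
  have hε2 : ε * (25 * (S + 1)) ≤ 1 := (le_div_iff₀ (by positivity)).1 (min_le_right _ _)
  have hγ₀ : ε / L * L = ε := div_mul_cancel₀ _ hL.ne'
  refine ⟨ε / L, L / 100, 1, by positivity, ?_, by positivity, one_pos,
    WaterTank.exists_isPerturbedEigenfamily hL (by positivity) (hγ₀.trans_le hε1), fun μ ψ χ h γ hγ => ?_⟩
  · gcongr
    linarith
  have hγε : γ * L ≤ ε := WaterTank.mul_le_of_mem_Ioo hL hγ₀.le hγ
  have hγL : γ * L ≤ 1 / 1000 := hγε.trans hε1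
  have hγL0 : 0 < γ * L := mul_pos hγ.1 hL
  have hd := WaterTank.isCoefficient_deltaExt hL hγ.1 (show γ * L ≤ 1 / 4 by linarith)
  choose s θ hP hend hzero hμ hψ hχ using h.exists_polar hL (hγ₀.trans_le hε1) hγ
  refine ⟨hd.isRieszBasisL2 hL hγL ?_ hP hend hψ,
    fun n => hd.norm_pairing_mem hL hγL (hP n) (hend n) (hψ n) (hχ n), fun n => ?_, ?_,
    fun n hn => hd.norm_moment_mem hL hγ.1 hγL (hP n) (hend n) hn (hχ n)⟩
  · change 25 * (γ * L) ^ 2 * S < 1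
    nlinarith [mul_le_mul_of_nonneg_right hγε hS]
  · rw [hμ, WaterTank.mu0_eq, ← mul_sub, ← Complex.ofReal_sub, norm_mul, Complex.norm_I, one_mul,
      Complex.norm_real]
    refine (hd.abs_sub_spectral_le hL (hP n) (hend n)).trans_lt ?_
    rw [lt_div_iff₀ (by positivity)]
    linarith
  -- The moment is a multiple of `∫ r sin θ`, and the angle for `n = 0` is identically zero.
  · rw [WaterTank.moment, WaterTank.pairing_congr hL.le (hχ 0) fun _ _ => rfl,
      WaterTank.pairing_smul_polar_controlProfile]
    simp [hzero 0 rfl]
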